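/- Let $Q$ be a finite quiver, let $k$ be a field, and let $I$ be an admissible ideal of the path algebra $kQ$ (paths are composed from left to right), that is, every path occurring with non-zero coefficient in an element of $I$ has length at least two, and there is an integer $N>1$ such that $I$ contains all paths of length $N$. Put $\Lambda = kQ/I$. Let $A$ be a (possibly empty) set of arrows of $Q$, and let $\langle A+I\rangle$ be the two-sided ideal of $\Lambda$ generated by the residue classes of the arrows in $A$. For $z\in kQ$ write uniquely $z = z_A + z_{\not A}$, where $z_A$ is a linear combination of paths passing through at least one arrow of $A$ and $z_{\not A}$ is a linear combination of paths avoiding all arrows of $A$. The set $A$ is called pre-removable if $z_A\in I$ and $z_{\not A}\in I$ for every $z\in I$. A pre-removable set $A$ is called * two-sided removable if $\langle A+I\rangle$ has finite projective dimension both as a right and as a left $\Lambda$-module; * only left removable if $\langle A+I\rangle^2=0$ and $\langle A+I\rangle$ has finite projective dimension as a right, but not as a left, $\Lambda$-module; * removable if it is two-sided removable or only left removable. For a ring $R$ let $\operatorname{fpd} R$ (respectively $\operatorname{Fpd} R$) be the supremum of the projective dimensions of the finitely generated (respectively all) left $R$-modules of finite projective dimension, and let $\operatorname{gd} R$ be the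 supremum of the projective dimensions of all left $R$-modules. **Theorem B.** Let $A$ be a removable set of arrows in $\Lambda = kQ/I$. Then $$\operatorname{fpd}\Lambda<\infty \iff \operatorname{fpd}\,\Lambda/\langle A+I\rangle<\infty,$$ and the equivalence remains valid if $\operatorname{fpd}$ is replaced by $\operatorname{Fpd}$ or by $\operatorname{gd}$. -/

import Mathlib

open CategoryTheory

universe u v w

noncomputable section

/-! ### Homological dimensions of a ring (modules are left modules) -/

/-- The little finitistic dimension of a ring: the supremum of the projective dimensions of the
finitely generated modules of finite projective dimension. The zero module has projective
dimension `⊥`. -/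
def littleFinitisticDim (R : Type u) [Ring R] : WithBot ℕ∞ :=
  ⨆ (M : ModuleCat.{u} R) (_ : Module.Finite R M) (_ : projectiveDimension M < ⊤),
    projectiveDimension M

/-- The big finitistic dimension of a ring: the supremum of the projective dimensions of all
modules of finite projective dimension. -/
def bigFinitisticDim (R : Type u) [Ring R] : WithBot ℕ∞ :=
  ⨆ (M : ModuleCat.{u} R) (_ : projectiveDimension M < ⊤), projectiveDimension M

/-- The global dimension of a ring: the supremum of the projective dimensions of all modules. -/
def globalDim (R : Type u) [Ring R] : WithBot ℕ∞ :=
  ⨆ M : ModuleCat.{u} R, projectiveDimension M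

/-! ### Path algebras -/

/-- The set of all paths of a quiver, including the trivial path `Quiver.Path.nil` at every
vertex. -/
abbrev AnyPath (V : Type v) [Quiver.{w} V] : Type (max v w) :=
  Σ a b : V, Quiver.Path a b

/-- The path algebra `k V`: the free `k`-module on the set of all paths. -/
def PathAlgebra (k : Type u) (V : Type v) [Field k] [Quiver.{w} V] : Type (max u v w) :=
  AnyPath V →₀ k

namespace PathAlgebra

variable (k : Type u) (V : Type v) [Field k] [Quiver.{w} V]

instance instAddCommGroup : AddCommGroup (PathAlgebra k V) := inferInstanceAs (AddCommGroup (AnyPath V →₀ k))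

instance instModule : Module k (PathAlgebra k V) := inferInstanceAs (Module k (AnyPath V →₀ k))

variable {V}

/-- A path, as an element of the path algebra. -/
def ofPath (p : AnyPath V) : PathAlgebra k V := Finsupp.single p 1

/-- An arrow, as an element of the path algebra. -/
def ofArrow (e : Quiver.Total V) : PathAlgebra k V := ofPath k ⟨e.left, e.right, e.hom.toPath⟩

open Classical in
/-- The product of two paths: the concatenation (first `p`, then `q`) if `p` ends where `q`
starts, and zero otherwise. -/
def pathMul (p q : AnyPath V) : PathAlgebra k V :=
  if h : p.2.1 = q.1 then ofPath k ⟨p.1, q.2.1, p.2.2.comp (q.2.2.cast h.symm rfl)⟩ else 0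

variable (V) in
/-- The bilinear extension of the product of paths. -/
def mulHom : PathAlgebra k V →ₗ[k] PathAlgebra k V →ₗ[k] PathAlgebra k V :=
  Finsupp.linearCombination k fun p : AnyPath V =>
    (Finsupp.linearCombination k fun q : AnyPath V => pathMul k p q :
      (AnyPath V →₀ k) →ₗ[k] PathAlgebra k V)

instance instMul : Mul (PathAlgebra k V) := ⟨fun x y => mulHom k V x y⟩

/-- The unit is the sum of all trivial paths. -/
instance instOne [Fintype V] : One (PathAlgebra k V) :=
  ⟨∑ a : V, ofPath k ⟨a, a, Quiver.Path.nil⟩⟩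

variable {k}

theorem mul_def (x y : PathAlgebra k V) : x * y = mulHom k V x y := rfl

theorem one_def [Fintype V] :
    (1 : PathAlgebra k V) = ∑ a : V, ofPath k ⟨a, a, Quiver.Path.nil⟩ := rfl

theorem ofPath_mul_ofPath (p q : AnyPath V) : ofPath k p * ofPath k q = pathMul k p q := by
  have h₁ : mulHom k V (ofPath k p) = (Finsupp.linearCombination k fun q : AnyPath V =>
      pathMul k p q : (AnyPath V →₀ k) →ₗ[k] PathAlgebra k V) :=
    (Finsupp.linearCombination_single k 1 p).trans (one_smul k _)
  rw [mul_def, h₁]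
  exact (Finsupp.linearCombination_single k 1 q).trans (one_smul k _)

theorem ofPath_mul_ofPath_comp {a b c : V} (p : Quiver.Path a b) (q : Quiver.Path b c) :
    ofPath k (⟨a, b, p⟩ : AnyPath V) * ofPath k ⟨b, c, q⟩ = ofPath k ⟨a, c, p.comp q⟩ := by
  simp [ofPath_mul_ofPath, pathMul]

theorem ofPath_mul_ofPath_of_ne {a b c d : V} (p : Quiver.Path a b) (q : Quiver.Path c d)
    (h : b ≠ c) : ofPath k (⟨a, b, p⟩ : AnyPath V) * ofPath k ⟨c, d, q⟩ = 0 := by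
  simp [ofPath_mul_ofPath, pathMul, h]

/-- Induction principle: the paths span the path algebra. -/
theorem induction_path {P : PathAlgebra k V → Prop} (x : PathAlgebra k V) (h0 : P 0)
    (hadd : ∀ x y, P x → P y → P (x + y)) (hpath : ∀ (r : k) (p : AnyPath V), P (r • ofPath k p)) :
    P x := by
  refine Finsupp.induction_linear (motive := P) x h0 hadd fun p r => ?_
  have h : (Finsupp.single p r : AnyPath V →₀ k) = r • Finsupp.single p 1 := by simp
  exact h ▸ hpath r p

theorem add_mul' (x y z : PathAlgebra k V) : (x + y) * z = x * z + y * z := by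
  simp [mul_def]

theorem mul_add' (x y z : PathAlgebra k V) : x * (y + z) = x * y + x * z := by
  simp [mul_def]

theorem zero_mul' (x : PathAlgebra k V) : 0 * x = 0 := by
  simp [mul_def]

theorem mul_zero' (x : PathAlgebra k V) : x * 0 = 0 := by
  simp [mul_def]

theorem smul_mul' (r : k) (x y : PathAlgebra k V) : (r • x) * y = r • (x * y) := by
  simp [mul_def]

theorem mul_smul' (r : k) (x y : PathAlgebra k V) : x * (r • y) = r • (x * y) := by
  simp [mul_def]

theorem sum_mul' {ι : Type*} (s : Finset ι) (f : ι → PathAlgebra k V)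
    (x : PathAlgebra k V) : (∑ i ∈ s, f i) * x = ∑ i ∈ s, f i * x := by
  simp [mul_def]

theorem mul_sum' {ι : Type*} (s : Finset ι) (f : ι → PathAlgebra k V)
    (x : PathAlgebra k V) : x * (∑ i ∈ s, f i) = ∑ i ∈ s, x * f i := by
  simp [mul_def]

theorem ofPath_assoc (p q r : AnyPath V) :
    ofPath k p * ofPath k q * ofPath k r = ofPath k p * (ofPath k q * ofPath k r) := by
  obtain ⟨a, b, p⟩ := p
  obtain ⟨c, d, q⟩ := q
  obtain ⟨e, f, r⟩ := r
  by_cases h₁ : b = c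
  · subst h₁
    by_cases h₂ : d = e
    · subst h₂
      simp [ofPath_mul_ofPath_comp]
    · rw [ofPath_mul_ofPath_comp, ofPath_mul_ofPath_of_ne _ _ h₂, ofPath_mul_ofPath_of_ne _ _ h₂,
        mul_zero']
  · rw [ofPath_mul_ofPath_of_ne _ _ h₁, zero_mul']
    by_cases h₂ : d = e
    · subst h₂
      rw [ofPath_mul_ofPath_comp, ofPath_mul_ofPath_of_ne _ _ h₁]
    · rw [ofPath_mul_ofPath_of_ne _ _ h₂, mul_zero']

theorem mul_assoc' (x y z : PathAlgebra k V) : x * y * z = x * (y * z) := by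
  induction x using induction_path with
  | h0 => simp only [zero_mul']
  | hadd x₁ x₂ h₁ h₂ => simp only [add_mul', h₁, h₂]
  | hpath r p =>
    induction y using induction_path with
    | h0 => simp only [zero_mul', mul_zero']
    | hadd y₁ y₂ h₁ h₂ => simp only [add_mul', mul_add', h₁, h₂]
    | hpath s q =>
      induction z using induction_path with
      | h0 => simp only [mul_zero']
      | hadd z₁ z₂ h₁ h₂ => simp only [mul_add', h₁, h₂]
      | hpath t l => simp only [smul_mul', mul_smul', ofPath_assoc]

theorem one_mul' [Fintype V] (x : PathAlgebra k V) : 1 * x = x := by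
  induction x using induction_path with
  | h0 => simp only [mul_zero']
  | hadd x₁ x₂ h₁ h₂ => simp only [mul_add', h₁, h₂]
  | hpath r p =>
    obtain ⟨a, b, p⟩ := p
    rw [mul_smul', one_def, sum_mul', Finset.sum_eq_single a, ofPath_mul_ofPath_comp,
      Quiver.Path.nil_comp]
    · exact fun c _ hc => ofPath_mul_ofPath_of_ne _ _ hc
    · simp

theorem mul_one' [Fintype V] (x : PathAlgebra k V) : x * 1 = x := by
  induction x using induction_path with
  | h0 => simp only [zero_mul']
  | hadd x₁ x₂ h₁ h₂ => simp only [add_mul', h₁, h₂]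
  | hpath r p =>
    obtain ⟨a, b, p⟩ := p
    rw [smul_mul', one_def, mul_sum', Finset.sum_eq_single b, ofPath_mul_ofPath_comp,
      Quiver.Path.comp_nil]
    · exact fun c _ hc => ofPath_mul_ofPath_of_ne _ _ hc.symm
    · simp

variable [Fintype V]

instance instRing : Ring (PathAlgebra k V) :=
  { (inferInstance : AddCommGroup (PathAlgebra k V)) with
    mul := (· * ·)
    one := 1
    left_distrib := mul_add'
    right_distrib := add_mul'
    zero_mul := zero_mul'
    mul_zero := mul_zero'
    mul_assoc := mul_assoc'
    one_mul := one_mul'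
    mul_one := mul_one' }

instance instAlgebra : Algebra k (PathAlgebra k V) := Algebra.ofModule smul_mul' mul_smul'

end PathAlgebra

/-! ### Bound quiver algebras and removable sets of arrows -/

section BoundQuiver

variable {k : Type u} {V : Type v} [Field k] [Quiver.{w} V]

/-- A path passes through (an arrow of) `A` if it is of the form `p₁ α p₂` with `α ∈ A`. -/
def PassesThrough (A : Set (Quiver.Total V)) (p : AnyPath V) : Prop :=
  ∃ α ∈ A, ∃ (p₁ : Quiver.Path p.1 α.left) (p₂ : Quiver.Path α.right p.2.1),
    p.2.2 = (p₁.cons α.hom).comp p₂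

open Classical in
/-- The part `z_A` of an element `z` of the path algebra that is supported on the paths passing
through some arrow of `A`. -/
def PathAlgebra.through (A : Set (Quiver.Total V)) (z : PathAlgebra k V) : PathAlgebra k V :=
  Finsupp.filter (fun p => PassesThrough A p) z

open Classical in
/-- The part of an element `z` of the path algebra that is supported on the paths avoiding all
arrows of `A`. -/
def PathAlgebra.avoiding (A : Set (Quiver.Total V)) (z : PathAlgebra k V) : PathAlgebra k V :=
  Finsupp.filter (fun p => ¬ PassesThrough A p) z

variable [Fintype V]

/-- An ideal `I` of the path algebra is admissible if every path occurring in (an element of) `I`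
has length at least two and, for some `N > 1`, all paths of length `N` are in `I`. -/
def IsAdmissible (I : TwoSidedIdeal (PathAlgebra k V)) : Prop :=
  (∀ z ∈ I, ∀ p ∈ Finsupp.support (α := AnyPath V) (M := k) z, 2 ≤ p.2.2.length) ∧
    ∃ N : ℕ, 1 < N ∧ ∀ p : AnyPath V, p.2.2.length = N → PathAlgebra.ofPath k p ∈ I

/-- The quotient algebra `k V / I`. -/
abbrev QuiverAlgebra (I : TwoSidedIdeal (PathAlgebra k V)) : Type (max u v w) :=
  I.ringCon.Quotient

/-- The ideal `⟨A + I⟩` of `k V / I` generated by the residue classes of the arrows in `A`. -/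
def arrowIdeal (I : TwoSidedIdeal (PathAlgebra k V)) (A : Set (Quiver.Total V)) :
    TwoSidedIdeal (QuiverAlgebra I) :=
  TwoSidedIdeal.span ((fun α => I.ringCon.mk' (PathAlgebra.ofArrow k α)) '' A)

/-- `A` is pre-removable in `k V / I`: for every `z ∈ I`, both the part of `z` supported on the
paths passing through `A` and the part supported on the paths avoiding `A` are in `I`. -/
def IsPreRemovable (I : TwoSidedIdeal (PathAlgebra k V)) (A : Set (Quiver.Total V)) : Prop :=
  ∀ z ∈ I, PathAlgebra.through A z ∈ I ∧ PathAlgebra.avoiding A z ∈ I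

/-- `⟨A + I⟩` has finite projective dimension as a left module over `k V / I`. -/
def FiniteLeftProjDim (I : TwoSidedIdeal (PathAlgebra k V)) (A : Set (Quiver.Total V)) : Prop :=
  projectiveDimension (ModuleCat.of (QuiverAlgebra I) (arrowIdeal I A)) < ⊤

/-- `⟨A + I⟩` has finite projective dimension as a right module over `k V / I`. -/
def FiniteRightProjDim (I : TwoSidedIdeal (PathAlgebra k V)) (A : Set (Quiver.Total V)) : Prop :=
  projectiveDimension (ModuleCat.of (QuiverAlgebra I)ᵐᵒᵖ (arrowIdeal I A)) < ⊤

/-- `A` is non-repetitive: `⟨A + I⟩ ^ 2 = 0`. -/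
def IsNonRepetitive (I : TwoSidedIdeal (PathAlgebra k V)) (A : Set (Quiver.Total V)) : Prop :=
  ∀ x ∈ arrowIdeal I A, ∀ y ∈ arrowIdeal I A, x * y = 0

/-- Two-sided removable sets of arrows. -/
def IsTwoSidedRemovable (I : TwoSidedIdeal (PathAlgebra k V)) (A : Set (Quiver.Total V)) : Prop :=
  IsPreRemovable I A ∧ FiniteRightProjDim I A ∧ FiniteLeftProjDim I A

/-- Only left removable sets of arrows: the projective dimension of `⟨A + I⟩` is finite on the
right only. -/
def IsOnlyLeftRemovable (I : TwoSidedIdeal (PathAlgebra k V)) (A : Set (Quiver.Total V)) : Prop :=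
  IsPreRemovable I A ∧ IsNonRepetitive I A ∧ FiniteRightProjDim I A ∧ ¬ FiniteLeftProjDim I A

/-- (Left) removable sets of arrows. -/
def IsRemovable (I : TwoSidedIdeal (PathAlgebra k V)) (A : Set (Quiver.Total V)) : Prop :=
  IsTwoSidedRemovable I A ∨ IsOnlyLeftRemovable I A

end BoundQuiver

end

/-!
Write `Λ = k V / I`, let `K` be the ideal of `Λ` generated by the arrows in `A`, and let `Γ = Λ /
K`, with projection `p : Λ → Γ`. Since `A` is pre-removable, deletion of the paths through `A`
induces a section `i : Γ → Λ` of `p` (`IsPreRemovable.exists_section`); and `K` is nilpotent since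
`I` is admissible. The rest of the argument concerns such a cleft extension of Noetherian rings.

* From `Γ` to `Λ`. As `K` has finite projective dimension as a right module, so has `Γ`, and every
  high syzygy `X` of a `Λ`-module is acyclic for `Γ ⊗ -`. For such `X`, the `Γ`-module `X / K X` has
  the same projective dimension as `X`: a projective resolution of `X` remains exact modulo `K`, and
  if `X / K X` is projective, then `X` is isomorphic to `Λ ⊗ (X / K X)`, by Nakayama's lemma. So a
  bound over `Γ` gives one over `Λ` (`hasSyzygyTransfer_projection`).
* From `Λ` to `Γ`. Restriction along `i` is an exact left inverse of the restriction along `p`, so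
  the latter is injective on `Ext` groups, and the projective dimension of a `Γ`-module is at most
  that of the `Λ`-module obtained from it by restriction along `p`
  (`hasProjectiveDimensionLT_of_restrictScalars`). This settles global dimensions. If `K` has finite
  projective dimension as a left module, too, then restriction along `p` preserves finiteness of
  projective dimensions, which settles the two-sided case.
* If `K ^ 2 = 0`, then the right `Λ`-module `K` is restricted from a `Γ`-module along `p`. So it has
  finite projective dimension over `Γ`, too, by the previous item for the opposite rings, and high
  syzygies of `Γ`-modules are acyclic for `Λ ⊗ -`, where the tensor product is over `Γ`. On acyclic
  modules this functor preserves projective dimensions, and a bound over `Λ` gives one over `Γ`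
  (`hasSyzygyTransfer_section`).

Both uses of acyclic syzygies are instances of `hasBoundedProjDim_of_adjunction`. There are no
tensor products over noncommutative rings in it: extension of scalars is a left adjoint of the
restriction of scalars, and the vanishing of `Tor` is expressed as the vanishing of `Ext` groups
into the character module of the ring, which is a cogenerator. It has finite injective dimension
after restriction because duals of projective right modules are injective
(`hasInjectiveDimensionLT_rightDual`).
-/

noncomputable section

open Limits Abelian

/-! ### Adjoint functors and projective dimensions -/

section HomologicalReduction

universe v₁ v₂ u₁ u₂ w₁

variable {C : Type u₁} [Category.{v₁} C] [Abelian C]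
variable {D : Type u₂} [Category.{v₂} D] [Abelian D]

/-- All `Ext` groups from `X` to `W` in degrees above `m` vanish. For `m = 0` and `W = U.obj E`,
where `U` has a left adjoint `F` and `E` is a cogenerator, this is acyclicity of `X` for `F`. -/
def ExtOrthogonal [HasExt.{w₁} C] (X W : C) (m : ℕ) : Prop :=
  ∀ i, m ≤ i → ∀ e : Ext X W (i + 1), e = 0

/-- Every object satisfying `P` has a syzygy (the kernel of an epimorphism from some projective
object) that again satisfies `P`. -/
def IsSyzygyClosed (P : C → Prop) : Prop :=
  ∀ X, P X → ∃ (S : ShortComplex C), S.ShortExact ∧ Projective S.X₂ ∧ S.X₃ = X ∧ P S.X₁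

/-- The projective dimensions of the objects satisfying `P` are bounded by a natural number. -/
def HasBoundedProjDim (P : C → Prop) : Prop :=
  ∃ n : ℕ, ∀ X, P X → HasProjectiveDimensionLT X n

theorem CategoryTheory.HasProjectiveDimensionLT.mono {X : C} {n m : ℕ}
    (h : HasProjectiveDimensionLT X n) (hnm : n ≤ m) : HasProjectiveDimensionLT X m :=
  hasProjectiveDimensionLT_of_ge X n m hnm

theorem ExtOrthogonal.syzygy [HasExt.{w₁} C] {W : C} {m m' : ℕ} {S : ShortComplex C}
    (hS : S.ShortExact) [Projective S.X₂] (h : ExtOrthogonal S.X₃ W m) (hm : m ≤ m' + 1) :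
    ExtOrthogonal S.X₁ W m' := by
  intro i hi e
  obtain ⟨x, rfl⟩ := Ext.contravariant_sequence_exact₁ hS W e (add_comm 1 (i + 1))
    (h _ (by lia) _)
  rw [Ext.eq_zero_of_projective x, Ext.comp_zero]

theorem extOrthogonal_of_hasInjectiveDimensionLT [HasExt.{w₁} C] {W : C} {m : ℕ}
    (h : HasInjectiveDimensionLT W (m + 1)) (X : C) : ExtOrthogonal X W m :=
  fun i hi e => e.eq_zero_of_hasInjectiveDimensionLT (m + 1) (by lia)

/-- If `W` has finite injective dimension, then sufficiently high syzygies of any object are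
orthogonal to `W`, so that it is enough to bound projective dimensions on the orthogonal objects. -/
theorem hasBoundedProjDim_of_extOrthogonal [HasExt.{w₁} C] {P : C → Prop}
    (hP : IsSyzygyClosed P) {W : C} {m : ℕ} (hW : HasInjectiveDimensionLT W m)
    (h : HasBoundedProjDim fun X => P X ∧ ExtOrthogonal X W 0) : HasBoundedProjDim P := by
  obtain ⟨n, hn⟩ := h
  have key : ∀ m X, P X → ExtOrthogonal X W m → HasProjectiveDimensionLT X (n + m) := by
    intro m
    induction m with
    | zero => exact fun X hX h0 => hn X ⟨hX, h0⟩
    | succ m ih =>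
      intro X hX hm
      obtain ⟨S, hS, hS₂, rfl, hS₁⟩ := hP X hX
      exact hS.hasProjectiveDimensionLT_X₃ (n + m) (ih _ hS₁ (hm.syzygy hS le_rfl)) inferInstance
  exact ⟨n + m, fun X hX => key m X hX (extOrthogonal_of_hasInjectiveDimensionLT
    (hasInjectiveDimensionLT_of_ge _ m _ (by lia)) X)⟩

/-- `E` is a cogenerator: morphisms to `E` detect whether a morphism is zero. -/
def IsCogenerator (E : D) : Prop :=
  ∀ ⦃X Y : D⦄ (f : X ⟶ Y), (∀ h : Y ⟶ E, f ≫ h = 0) → f = 0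

variable {F : C ⥤ D} {U : D ⥤ C}

/-- A left adjoint `F` preserves short exact sequences that end in an object orthogonal to `U.obj
E`. The left exactness can be tested on morphisms to the cogenerator `E`, and these correspond to
morphisms to `U.obj E`, which extend along `S.f` because the obstruction lies in `Ext S.X₃ (U.obj E)
1`. -/
theorem map_shortExact_of_extOrthogonal [HasExt.{w₁} C] [F.Additive] (adj : F ⊣ U) {E : D}
    (hE : IsCogenerator E) {S : ShortComplex C} (hS : S.ShortExact)
    (h : ExtOrthogonal S.X₃ (U.obj E) 0) : (S.map F).ShortExact := by
  have := adj.leftAdjoint_preservesColimits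
  have := hS.epi_g
  have hex : (S.map F).Exact ∧ Epi (S.map F).g := by
    have := (Functor.preservesFiniteColimits_tfae F).out 3 0
    exact this.1 inferInstance S hS
  have hmono : Mono (S.map F).f := by
    change Mono (F.map S.f)
    refine Preadditive.mono_of_cancel_zero _ fun {G} g hg => hE g fun t => ?_
    obtain ⟨x, hx⟩ := Ext.contravariant_sequence_exact₁ hS (U.obj E)
      (Ext.mk₀ (adj.homEquiv _ _ t)) (add_comm 1 0) (h 0 le_rfl _)
    obtain ⟨y, rfl⟩ := Ext.homEquiv₀.symm.surjective x
    have hxy : S.f ≫ y = adj.homEquiv _ _ t := by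
      apply Ext.homEquiv₀.symm.injective
      simpa using hx
    have : F.map S.f ≫ (adj.homEquiv _ _).symm y = t := by
      rw [← adj.homEquiv_naturality_left_symm, hxy, Equiv.symm_apply_apply]
    rw [← this, ← Category.assoc, hg, zero_comp]
  have := hex.2
  exact { exact := hex.1 }

/-- On orthogonal objects, a left adjoint of an exact functor does not raise projective dimensions.
-/
theorem hasProjectiveDimensionLT_map [HasExt.{w₁} C] [F.Additive] [EnoughProjectives C]
    (adj : F ⊣ U) [U.PreservesEpimorphisms] {E : D} (hE : IsCogenerator E) {X : C}
    (hX : ExtOrthogonal X (U.obj E) 0) {n : ℕ} (h : HasProjectiveDimensionLT X n) :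
    HasProjectiveDimensionLT (F.obj X) n := by
  have hproj : ∀ X : C, Projective X → Projective (F.obj X) := fun X hX => adj.map_projective X hX
  induction n generalizing X with
  | zero =>
    exact (F.map_isZero
      (isZero_of_hasProjectiveDimensionLT_zero X)).hasProjectiveDimensionLT_zero
  | succ n ih =>
    let P : ProjectivePresentation X := Classical.arbitrary _
    let S := ShortComplex.mk _ _ (kernel.condition P.f)
    have hS : S.ShortExact := { exact := ShortComplex.exact_kernel P.f }
    have hS₂ : Projective S.X₂ := P.projective
    obtain _ | n := n
    · have := hproj X (projective_iff_hasProjectiveDimensionLT_one.2 h)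
      infer_instance
    · have h₁ : HasProjectiveDimensionLT S.X₁ (n + 1) :=
        (hS.hasProjectiveDimensionLT_X₃_iff n hS₂).1 h
      have hFS := map_shortExact_of_extOrthogonal adj hE hS hX
      exact (hFS.hasProjectiveDimensionLT_X₃_iff n (hproj _ hS₂)).2
        (ih (ExtOrthogonal.syzygy hS hX (by lia)) h₁)

/-- Converse of `hasProjectiveDimensionLT_map`: if `F` reflects projectivity of orthogonal objects,
it does not lower their projective dimensions, except possibly for making them zero. -/
theorem hasProjectiveDimensionLT_of_map [HasExt.{w₁} C] [F.Additive] [EnoughProjectives C]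
    (adj : F ⊣ U) [U.PreservesEpimorphisms] {E : D} (hE : IsCogenerator E)
    (hF : ∀ X, ExtOrthogonal X (U.obj E) 0 → Projective (F.obj X) → Projective X) {X : C}
    (hX : ExtOrthogonal X (U.obj E) 0) {n : ℕ} (h : HasProjectiveDimensionLT (F.obj X) (n + 1)) :
    HasProjectiveDimensionLT X (n + 1) := by
  induction n generalizing X with
  | zero =>
    have := hF X hX inferInstance
    infer_instance
  | succ n ih =>
    let P : ProjectivePresentation X := Classical.arbitrary _
    let S := ShortComplex.mk _ _ (kernel.condition P.f)
    have hS : S.ShortExact := { exact := ShortComplex.exact_kernel P.f }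
    have hS₂ : Projective S.X₂ := P.projective
    have hFS := map_shortExact_of_extOrthogonal adj hE hS hX
    have h₁ := (hFS.hasProjectiveDimensionLT_X₃_iff n (adj.map_projective _ hS₂)).1 h
    exact (hS.hasProjectiveDimensionLT_X₃_iff n hS₂).2
        (ih (ExtOrthogonal.syzygy hS hX (by lia)) h₁)

/-- The transfer principle behind all comparisons of finitistic dimensions below. -/
theorem hasBoundedProjDim_of_adjunction [HasExt.{w₁} C] [F.Additive] [EnoughProjectives C]
    (adj : F ⊣ U) [U.PreservesEpimorphisms] {E : D} (hE : IsCogenerator E)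
    (hF : ∀ X, ExtOrthogonal X (U.obj E) 0 → Projective (F.obj X) → Projective X)
    {m : ℕ} (hUE : HasInjectiveDimensionLT (U.obj E) m)
    {P : C → Prop} (hP : IsSyzygyClosed P) {P' : D → Prop}
    (hPP' : ∀ X, ExtOrthogonal X (U.obj E) 0 → P X → P' (F.obj X))
    (h : HasBoundedProjDim P') : HasBoundedProjDim P := by
  obtain ⟨n, hn⟩ := h
  exact hasBoundedProjDim_of_extOrthogonal hP hUE ⟨n + 1, fun X hX =>
    hasProjectiveDimensionLT_of_map adj hE hF hX.2
      ((hn _ (hPP' X hX.2 hX.1)).mono n.le_succ)⟩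

/-! ### Functors with a left inverse -/

section Cleft

variable {L : D ⥤ C} {V : C ⥤ D}

/-- If `V` is a left inverse of `U`, then a left adjoint of `V` is a right inverse of a left adjoint
of `U`. -/
def leftAdjointCompIso (adj : F ⊣ U) (adjL : L ⊣ V) (φ : U ⋙ V ≅ 𝟭 D) : L ⋙ F ≅ 𝟭 D :=
  ((adjL.comp adj).ofNatIsoRight φ).leftAdjointUniq Adjunction.id

omit [Abelian C] [Abelian D] in
theorem projective_of_projective_leftAdjoint (adj : F ⊣ U) (adjL : L ⊣ V) (φ : U ⋙ V ≅ 𝟭 D)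
    [U.PreservesEpimorphisms] {Y : D} (hY : Projective (L.obj Y)) : Projective Y :=
  Projective.of_iso ((leftAdjointCompIso adj adjL φ).app Y) (adj.map_projective _ hY)

theorem epi_of_epi_map [F.Additive] (adj : F ⊣ U) (hF : ∀ X, IsZero (F.obj X) → IsZero X)
    {X Y : C} (f : X ⟶ Y) [Epi (F.map f)] : Epi f := by
  have := adj.leftAdjoint_preservesColimits
  refine Preadditive.epi_of_isZero_cokernel f (hF _ ?_)
  have h0 : F.map (cokernel.π f) = 0 := by
    rw [← cancel_epi (F.map f), ← F.map_comp, cokernel.condition, F.map_zero, comp_zero]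
  exact (IsZero.iff_id_eq_zero _).2 ((cancel_epi (F.map (cokernel.π f))).1 (by rw [h0]; simp))

/-- Let `V` be a left inverse of the fully faithful functor `U`, and let `L` and `F` be left
adjoints of `V` and `U`. If `F` kills no nonzero object, then it reflects projectivity of orthogonal
objects: a section of `V.obj X ⟶ F.obj X` corresponds to a morphism `L.obj (F.obj X) ⟶ X` that
becomes an isomorphism under `F`, hence is an isomorphism, by a version of Nakayama's lemma. -/
theorem projective_of_projective_map [HasExt.{w₁} C] [F.Additive] [U.Full] [U.Faithful]
    [V.PreservesEpimorphisms] (adj : F ⊣ U) (adjL : L ⊣ V) (φ : U ⋙ V ≅ 𝟭 D)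
    (hF : ∀ X, IsZero (F.obj X) → IsZero X) {E : D} (hE : IsCogenerator E) {X : C}
    (hX : ExtOrthogonal X (U.obj E) 0) (h : Projective (F.obj X)) : Projective X := by
  -- As `U` is fully faithful, the unit becomes an isomorphism under `F`.
  have hη : Epi (adj.unit.app X) := by
    have : F.map (adj.unit.app X) = inv (adj.counit.app (F.obj X)) :=
      IsIso.eq_inv_of_inv_hom_id (adj.left_triangle_components X)
    have : Epi (F.map (adj.unit.app X)) := by rw [this]; infer_instance
    exact epi_of_epi_map adj hF _
  let p : V.obj X ⟶ F.obj X := V.map (adj.unit.app X) ≫ φ.hom.app (F.obj X)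
  let s : F.obj X ⟶ V.obj X := Projective.factorThru (𝟙 _) p
  have hs : s ≫ V.map (adj.unit.app X) = φ.inv.app (F.obj X) := by
    have : s ≫ p = 𝟙 _ := Projective.factorThru_comp _ _
    rw [← cancel_mono (φ.hom.app (F.obj X)), Category.assoc]
    simpa using this
  let c : L.obj (F.obj X) ⟶ X := (adjL.homEquiv _ _).symm s
  -- Under the two adjunctions, precomposition with `F.map c` is the natural isomorphism `φ`.
  have hFc : IsIso (F.map c) := by
    rw [isIso_iff_coyoneda_map_bijective]
    intro W
    have hcomp : ∀ g : F.obj X ⟶ W, adjL.homEquiv _ _ (adj.homEquiv _ _ (F.map c ≫ g)) =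
        φ.inv.app (F.obj X) ≫ V.map (U.map g) := by
      intro g
      rw [adj.homEquiv_naturality_left, adjL.homEquiv_naturality_right, Equiv.apply_symm_apply,
        adj.homEquiv_unit, V.map_comp, reassoc_of% hs]
    have hbij : Function.Bijective fun g : F.obj X ⟶ W =>
        φ.inv.app (F.obj X) ≫ V.map (U.map g) := by
      have : (fun g : F.obj X ⟶ W => φ.inv.app (F.obj X) ≫ V.map (U.map g)) =
          fun g => g ≫ φ.inv.app W := by
        funext g
        exact (φ.inv.naturality g).symm
      rw [this]
      exact ⟨fun a b hab => (cancel_mono _).1 hab, fun b => ⟨b ≫ φ.hom.app W, by simp⟩⟩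
    have h2 : (fun g : F.obj X ⟶ W => φ.inv.app (F.obj X) ≫ V.map (U.map g)) =
      ((adj.homEquiv _ _).trans (adjL.homEquiv _ _)) ∘ fun g => F.map c ≫ g := by
      funext g
      exact (hcomp g).symm
    rw [h2] at hbij
    exact (Equiv.comp_bijective _ _).1 hbij
  have hc : Epi c := epi_of_epi_map adj hF c
  let S := ShortComplex.mk _ _ (kernel.condition c)
  have hS : S.ShortExact := { exact := ShortComplex.exact_kernel c }
  have hFS := map_shortExact_of_extOrthogonal adj hE hS hX
  -- The kernel of `c` is killed by `F`, since `F` is exact on `0 → kernel c → L (F X) → X → 0`.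
  have hmono : Mono c := by
    refine Preadditive.mono_of_isZero_kernel c (hF _ ?_)
    have := hFS.mono_f
    change Mono (F.map (kernel.ι c)) at this
    have h0 : F.map (kernel.ι c) = 0 := by
      rw [← cancel_mono (F.map c), ← F.map_comp, kernel.condition, F.map_zero, zero_comp]
    exact (IsZero.iff_id_eq_zero _).2 ((cancel_mono (F.map (kernel.ι c))).1 (by rw [h0]; simp))
  have : IsIso c := isIso_of_mono_of_epi c
  exact Projective.of_iso (asIso c) (adjL.map_projective _ h)

end Cleft

/-! ### Exact retractions and `Ext` -/

section Retract

/-- If exact functors `U` and `V` satisfy `U ⋙ V ≅ 𝟭 D`, then the composite of the maps which they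
induce on `Ext` groups is the identity, up to that isomorphism. -/
theorem mapExactFunctor_mapExactFunctor_comp [HasExt.{w₁} C] [HasExt.{w₁} D] [EnoughProjectives D]
    (U : D ⥤ C) (V : C ⥤ D)
    [U.Additive] [PreservesFiniteLimits U] [PreservesFiniteColimits U]
    [V.Additive] [PreservesFiniteLimits V] [PreservesFiniteColimits V] (φ : U ⋙ V ≅ 𝟭 D)
    {X Y : D} {n : ℕ} (e : Ext X Y n) :
    ((e.mapExactFunctor U).mapExactFunctor V).comp (Ext.mk₀ (φ.hom.app Y)) (add_zero n) =
      (Ext.mk₀ (φ.hom.app X)).comp e (zero_add n) := by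
  induction n generalizing X with
  | zero =>
    obtain ⟨f, rfl⟩ := Ext.homEquiv₀.symm.surjective e
    have := φ.hom.naturality f
    simp only [Functor.comp_map, Functor.id_map] at this
    simp [Ext.mapExactFunctor_mk₀, this]
  | succ n ih =>
    let P : ProjectivePresentation X := Classical.arbitrary _
    let S := ShortComplex.mk _ _ (kernel.condition P.f)
    have hS : S.ShortExact := { exact := ShortComplex.exact_kernel P.f }
    have hS₂ : Projective S.X₂ := P.projective
    obtain ⟨x, rfl⟩ := Ext.contravariant_sequence_exact₃ hS Y e (Ext.eq_zero_of_projective _)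
      (add_comm 1 n)
    have hnat : ((hS.extClass.mapExactFunctor U).mapExactFunctor V).comp
        (Ext.mk₀ (φ.hom.app S.X₁)) (add_zero 1) =
        (Ext.mk₀ (φ.hom.app S.X₃)).comp hS.extClass (zero_add 1) :=
      (congrArg (fun y => y.comp (Ext.mk₀ (φ.hom.app S.X₁)) (add_zero 1))
        ((congrArg _ (Ext.mapExactFunctor_extClass U hS)).trans
          (Ext.mapExactFunctor_extClass V (hS.map_of_exact U)))).trans
      (ShortComplex.ShortExact.extClass_naturality ((hS.map_of_exact U).map_of_exact V) hS
        { τ₁ := φ.hom.app S.X₁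
          τ₂ := φ.hom.app S.X₂
          τ₃ := φ.hom.app S.X₃
          comm₁₂ := (φ.hom.naturality S.f).symm
          comm₂₃ := (φ.hom.naturality S.g).symm })
    rw [Ext.mapExactFunctor_comp, Ext.mapExactFunctor_comp, Ext.comp_assoc_of_third_deg_zero, ih,
      ← Ext.comp_assoc_of_second_deg_zero, hnat,
      Ext.comp_assoc _ _ _ (zero_add 1) (add_comm 1 n) (by lia)]

/-- If `V` is an exact left inverse of the exact functor `U`, then `U` is injective on `Ext` groups,
and so it does not lower projective dimensions. -/
theorem hasProjectiveDimensionLT_of_retract [HasExt.{w₁} C] [HasExt.{w₁} D] [EnoughProjectives D]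
    (U : D ⥤ C) (V : C ⥤ D)
    [U.Additive] [PreservesFiniteLimits U] [PreservesFiniteColimits U]
    [V.Additive] [PreservesFiniteLimits V] [PreservesFiniteColimits V] (φ : U ⋙ V ≅ 𝟭 D)
    {X : D} {n : ℕ} (h : HasProjectiveDimensionLT (U.obj X) n) : HasProjectiveDimensionLT X n := by
  rw [hasProjectiveDimensionLT_iff]
  intro i hi Y e
  have key := mapExactFunctor_mapExactFunctor_comp U V φ e
  have h0 : e.mapExactFunctor U = 0 := Ext.eq_zero_of_hasProjectiveDimensionLT _ n hi
  rw [h0, Ext.mapExactFunctor_zero, Ext.zero_comp] at key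
  have h2 : e = (Ext.mk₀ (φ.inv.app X)).comp ((Ext.mk₀ (φ.hom.app X)).comp e (zero_add i))
      (zero_add i) := by
    rw [Ext.mk₀_comp_mk₀_assoc]
    simp
  rw [h2, ← key, Ext.comp_zero]

end Retract

end HomologicalReduction

/-! ### Duals of right modules -/

section ChangeOfRings

variable {R S : Type u} [Ring R] [Ring S]

instance restrictScalars_preservesLimits (f : R →+* S) :
    PreservesLimits (ModuleCat.restrictScalars.{u} f) := by
  have : PreservesLimits (ModuleCat.restrictScalars.{u} f ⋙ forget (ModuleCat.{u} R)) :=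
    inferInstanceAs (PreservesLimits (forget (ModuleCat.{u} S)))
  exact preservesLimits_of_reflects_of_preserves _ (forget (ModuleCat.{u} R))


/-- The dual of a right `R`-module `M`, that is, of a module over `Rᵐᵒᵖ`: the group of additive maps
from `M` to `ℚ / ℤ`. It is a left `R`-module. The type synonym avoids the module structure of
`CharacterModule` over a commutative ring. -/
def RightDual (M : Type u) [AddCommGroup M] : Type u := CharacterModule M

namespace RightDual

variable (M : Type u) [AddCommGroup M]

instance : AddCommGroup (RightDual M) := inferInstanceAs (AddCommGroup (CharacterModule M))

instance : FunLike (RightDual M) M (AddCircle (1 : ℚ)) :=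
  inferInstanceAs (FunLike (CharacterModule M) M (AddCircle (1 : ℚ)))

instance : AddMonoidHomClass (RightDual M) M (AddCircle (1 : ℚ)) :=
  inferInstanceAs (AddMonoidHomClass (M →+ AddCircle (1 : ℚ)) M (AddCircle (1 : ℚ)))

variable {M}

@[ext] theorem ext {c d : RightDual M} (h : ∀ x, c x = d x) : c = d := DFunLike.ext _ _ h

@[simp] theorem add_apply (c d : RightDual M) (x : M) : (c + d) x = c x + d x := rfl

@[simp] theorem zero_apply (x : M) : (0 : RightDual M) x = 0 := rfl

instance [Module Rᵐᵒᵖ M] : Module R (RightDual M) where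
  smul r c := AddMonoidHom.comp (c : M →+ AddCircle (1 : ℚ))
    (DistribSMul.toAddMonoidHom M (MulOpposite.op r))
  one_smul c := DFunLike.ext _ _ fun x => congrArg c (one_smul _ x)
  mul_smul r s c := DFunLike.ext _ _ fun x =>
    congrArg c (mul_smul (MulOpposite.op s) (MulOpposite.op r) x)
  smul_zero _ := rfl
  smul_add _ _ _ := rfl
  add_smul r s c := DFunLike.ext _ _ fun x =>
    (congrArg c (add_smul (MulOpposite.op r) (MulOpposite.op s) x)).trans (map_add c _ _)
  zero_smul c := DFunLike.ext _ _ fun x =>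
    (congrArg c (zero_smul Rᵐᵒᵖ x)).trans (map_zero c)

@[simp] theorem smul_apply [Module Rᵐᵒᵖ M] (r : R) (c : RightDual M) (x : M) :
    (r • c) x = c (MulOpposite.op r • x) := rfl

variable {N : Type u} [AddCommGroup N]

variable [Module Rᵐᵒᵖ M] [Module Rᵐᵒᵖ N]

/-- The dual of a linear map. -/
def map (f : M →ₗ[Rᵐᵒᵖ] N) : RightDual N →ₗ[R] RightDual M where
  toFun c := AddMonoidHom.comp (c : N →+ AddCircle (1 : ℚ)) f.toAddMonoidHom
  map_add' _ _ := rfl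
  map_smul' r c := DFunLike.ext _ _ fun x => congrArg c (f.map_smul (MulOpposite.op r) x).symm

omit [Module Rᵐᵒᵖ M] [Module Rᵐᵒᵖ N] in
/-- Characters extend along injective maps, as `ℚ / ℤ` is divisible. -/
theorem exists_extension (f : M →+ N) (hf : Function.Injective f)
    (c : M →+ AddCircle (1 : ℚ)) : ∃ d : N →+ AddCircle (1 : ℚ), ∀ x, d (f x) = c x := by
  obtain ⟨d, hd⟩ := CharacterModule.dual_surjective_of_injective f.toIntLinearMap hf
    (c : CharacterModule M)
  exact ⟨d, fun x => DFunLike.congr_fun hd x⟩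

theorem map_surjective {f : M →ₗ[Rᵐᵒᵖ] N} (hf : Function.Injective f) :
    Function.Surjective (map f) := fun c => by
  obtain ⟨d, hd⟩ := exists_extension f.toAddMonoidHom hf c
  exact ⟨d, ext hd⟩

theorem map_injective {f : M →ₗ[Rᵐᵒᵖ] N} (hf : Function.Surjective f) :
    Function.Injective (map f) := fun c d h => ext fun y => by
  obtain ⟨x, rfl⟩ := hf y
  exact DFunLike.congr_fun h x

theorem exact_map {L : Type u} [AddCommGroup L] [Module Rᵐᵒᵖ L] {f : L →ₗ[Rᵐᵒᵖ] M}
    {g : M →ₗ[Rᵐᵒᵖ] N} (hfg : Function.Exact f g) (hg : Function.Surjective g) :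
    Function.Exact (map g) (map f) := by
  intro c
  constructor
  · intro h
    have hc : ∀ x, g x = 0 → c x = 0 := fun x hx => by
      obtain ⟨y, rfl⟩ := (hfg x).1 hx
      exact DFunLike.congr_fun h y
    let e := QuotientAddGroup.quotientKerEquivOfSurjective g.toAddMonoidHom hg
    let d : N →+ AddCircle (1 : ℚ) :=
      (QuotientAddGroup.lift g.toAddMonoidHom.ker (c : M →+ AddCircle (1 : ℚ)) hc).comp
        e.symm.toAddMonoidHom
    refine ⟨d, ext fun x => ?_⟩
    have : e.symm (g x) = QuotientAddGroup.mk x := (AddEquiv.symm_apply_eq e).2 rfl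
    change QuotientAddGroup.lift _ _ hc (e.symm (g x)) = c x
    rw [this]
    rfl
  · rintro ⟨d, rfl⟩
    exact ext fun y => (congrArg d (hfg.apply_apply_eq_zero y)).trans (map_zero d)

variable (R M) in
/-- The dual of a projective right module is injective. For the free right module with basis `M`, a
linear map from `X` to the dual is a family of characters of `X` indexed by `M`, and these extend to
`Y`; a section `s` of the canonical surjection onto `M` reduces the general case to this one. -/
theorem injective_of_projective [Module.Projective Rᵐᵒᵖ M] : Module.Injective R (RightDual M) := by
  refine ⟨fun X Y _ _ _ _ f hf g => ?_⟩
  obtain ⟨s, hs⟩ := (Module.projective_def (R := Rᵐᵒᵖ) (P := M)).1 inferInstance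
  have h1 : ∀ b : M, ∃ d : Y →+ AddCircle (1 : ℚ), ∀ x, d (f x) = g x b := fun b =>
    exists_extension f.toAddMonoidHom hf
      { toFun := fun x => g x b, map_zero' := by simp, map_add' := by simp }
  choose d hd using h1
  -- The pairing of `Y` with the free right module on `M` given by the extended characters.
  let act (y : Y) : (M →₀ Rᵐᵒᵖ) →+ AddCircle (1 : ℚ) := Finsupp.liftAddHom fun b =>
    { toFun := fun a => d b (a.unop • y), map_zero' := by simp, map_add' := by simp [add_smul] }
  have act_single : ∀ y b a, act y (Finsupp.single b a) = d b (a.unop • y) := by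
    intro y b a
    simp [act]
  have act_add : ∀ y y' z, act (y + y') z = act y z + act y' z := by
    intro y y' z
    induction z using Finsupp.induction_linear with
    | zero => simp
    | add a b ha hb => rw [map_add, map_add, map_add, ha, hb]; abel
    | single b a => simp [act_single]
  have act_smul : ∀ (r : R) y z, act (r • y) z = act y (MulOpposite.op r • z) := by
    intro r y z
    induction z using Finsupp.induction_linear with
    | zero => simp
    | add a b ha hb => rw [smul_add, map_add, map_add, ha, hb]
    | single b a =>
      rw [Finsupp.smul_single, act_single, act_single, smul_eq_mul, MulOpposite.unop_mul,
        MulOpposite.unop_op, mul_smul]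
  have act_f : ∀ x z, act (f x) z = g x (Finsupp.linearCombination Rᵐᵒᵖ id z) := by
    intro x z
    induction z using Finsupp.induction_linear with
    | zero => simp
    | add a b ha hb => rw [map_add, map_add, map_add, ha, hb]
    | single b a =>
      rw [act_single, ← map_smul, hd]
      simp
  let h : Y →ₗ[R] RightDual M :=
    { toFun := fun y => (act y).comp s.toAddMonoidHom
      map_add' := fun y y' => ext fun m => act_add y y' (s m)
      map_smul' := fun r y => ext fun m => by
        change act (r • y) (s m) = act y (s (MulOpposite.op r • m))
        rw [act_smul, s.map_smul] }
  refine ⟨h, fun x => ext fun m => ?_⟩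
  change act (f x) (s m) = g x m
  rw [act_f, hs]

end RightDual

theorem hasInjectiveDimensionLT_rightDual (M : ModuleCat.{u} Rᵐᵒᵖ) {n : ℕ}
    (h : HasProjectiveDimensionLT M n) :
    HasInjectiveDimensionLT (ModuleCat.of R (RightDual M)) n := by
  have hproj : ∀ M : ModuleCat.{u} Rᵐᵒᵖ, Projective M →
      Injective (ModuleCat.of R (RightDual M)) := fun M hM => by
    have := (IsProjective.iff_projective M).2 hM
    have := RightDual.injective_of_projective R M
    exact Module.injective_object_of_injective_module R _
  induction n generalizing M with
  | zero =>
    have := ModuleCat.subsingleton_of_isZero (isZero_of_hasProjectiveDimensionLT_zero M)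
    refine IsZero.hasInjectiveDimensionLT_zero (@ModuleCat.isZero_of_subsingleton _ _ _ ⟨?_⟩)
    intro c d
    exact RightDual.ext fun x => by rw [Subsingleton.elim x 0, map_zero, map_zero]
  | succ n ih =>
    obtain _ | n := n
    · have := hproj M (projective_iff_hasProjectiveDimensionLT_one.2 h)
      infer_instance
    · let T := M.projectiveShortComplex
      have hT : T.ShortExact := M.shortExact_projectiveShortComplex
      have hT₂ : Projective T.X₂ := inferInstance
      have h1 := (hT.hasProjectiveDimensionLT_X₃_iff n hT₂).1 h
      have hinj : Function.Injective T.f.hom := (ModuleCat.mono_iff_injective _).1 hT.mono_f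
      have hsurj : Function.Surjective T.g.hom := (ModuleCat.epi_iff_surjective _).1 hT.epi_g
      have hex : Function.Exact T.f.hom T.g.hom :=
        (ShortComplex.ShortExact.moduleCat_exact_iff_function_exact _).1 hT.exact
      have hex' := RightDual.exact_map (R := R) hex hsurj
      let T' : ShortComplex (ModuleCat.{u} R) := ShortComplex.mk
        (ModuleCat.ofHom (RightDual.map (R := R) T.g.hom))
        (ModuleCat.ofHom (RightDual.map (R := R) T.f.hom))
        (ModuleCat.hom_ext hex'.linearMap_comp_eq_zero)
      have hT' : T'.ShortExact :=
        { exact := (ShortComplex.ShortExact.moduleCat_exact_iff_function_exact _).2 hex'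
          mono_f := (ModuleCat.mono_iff_injective _).2 (RightDual.map_injective hsurj)
          epi_g := (ModuleCat.epi_iff_surjective _).2 (RightDual.map_surjective hinj) }
      exact hT'.hasInjectiveDimensionLT_X₁ (n + 1) (ih _ h1)
        (have := hproj T.X₂ hT₂
         (inferInstance : HasInjectiveDimensionLT (ModuleCat.of R (RightDual T.X₂)) (n + 2)))

variable (R) in
/-- The dual of `R`, viewed as a right module over itself. -/
abbrev ringDual : ModuleCat.{u} R := ModuleCat.of R (RightDual R)

variable (R) in
/-- Linear maps `Y → ringDual R` are the characters of `Y`, and these separate points. -/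
theorem isCogenerator_ringDual : IsCogenerator (ringDual R) := by
  intro X Y f hf
  ext x : 2
  refine CharacterModule.eq_zero_of_character_apply fun c => ?_
  let h : Y ⟶ ringDual R := ModuleCat.ofHom
    { toFun := fun y => (c : Y →+ AddCircle (1 : ℚ)).comp
        ((LinearMap.toSpanSingleton R Y y).toAddMonoidHom)
      map_add' := fun y y' => RightDual.ext fun r => by
        change c (r • (y + y')) = c (r • y) + c (r • y')
        rw [smul_add, map_add]
      map_smul' := fun a y => RightDual.ext fun r => by
        change c (r • a • y) = c ((r * a) • y)
        rw [mul_smul] }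
  have h1 := congrArg (fun g : X ⟶ ringDual R => (g.hom x : RightDual R) (1 : R)) (hf h)
  change c ((1 : R) • f.hom x) = 0 at h1
  rwa [one_smul] at h1

/-! ### Change of rings -/

/-- Restriction of scalars has a left adjoint, by the special adjoint functor theorem. (`Mathlib`
has the extension of scalars for commutative rings only.) -/
theorem restrictScalars_isRightAdjoint (f : R →+* S) :
    (ModuleCat.restrictScalars.{u} f).IsRightAdjoint := by
  have hco : (ObjectProperty.singleton (ringDual S)).IsCoseparating := by
    intro X Y g g' h
    rw [← sub_eq_zero]
    refine isCogenerator_ringDual S _ fun c => ?_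
    rw [Preadditive.sub_comp, h _ ⟨()⟩ c, sub_self]
  exact isRightAdjoint_of_preservesLimits_of_isCoseparating hco _

/-- A semilinear additive equivalence, as an isomorphism to a module with restricted scalars. -/
def isoRestrictScalars (f : R →+* S) {X : ModuleCat.{u} R} {Y : ModuleCat.{u} S} (e : X ≃+ Y)
    (he : ∀ (r : R) x, e (r • x) = f r • e x) : X ≅ (ModuleCat.restrictScalars f).obj Y :=
  letI := Module.compHom Y f
  LinearEquiv.toModuleIso (R := R) (X₁ := X) (X₂ := Y) { e with map_smul' := he }

theorem finite_leftAdjoint (f : R →+* S) {F : ModuleCat.{u} R ⥤ ModuleCat.{u} S}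
    (adj : F ⊣ ModuleCat.restrictScalars.{u} f) (X : ModuleCat.{u} R) [hX : Module.Finite R X] :
    Module.Finite S (F.obj X) := by
  obtain ⟨t, ht⟩ := hX.fg_top
  let η : X →+ F.obj X := (adj.unit.app X).hom.toAddMonoidHom
  have hη : ∀ (r : R) x, η (r • x) = f r • η x := fun r x => (adj.unit.app X).hom.map_smul r x
  let N : Submodule S (F.obj X) := Submodule.span S (η '' t)
  have hN : ∀ x, η x ∈ N := by
    intro x
    have hx : x ∈ Submodule.span R (t : Set X) := ht ▸ Submodule.mem_top
    induction hx using Submodule.span_induction with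
    | mem x hx => exact Submodule.subset_span ⟨x, hx, rfl⟩
    | zero => rw [map_zero]; exact N.zero_mem
    | add x y _ _ hx hy => rw [map_add]; exact N.add_mem hx hy
    | smul r x _ hx => rw [hη]; exact N.smul_mem _ hx
  have h0 : ModuleCat.ofHom N.mkQ = 0 := by
    apply (adj.homEquiv X (ModuleCat.of S (F.obj X ⧸ N))).injective
    rw [adj.homEquiv_unit, adj.homEquiv_unit]
    ext x
    change N.mkQ (η x) = 0
    exact (Submodule.Quotient.mk_eq_zero N).2 (hN x)
  have hN' : N = ⊤ := by
    refine Submodule.eq_top_iff'.2 fun y => (Submodule.Quotient.mk_eq_zero N).1 ?_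
    exact congrArg (fun g : F.obj X ⟶ ModuleCat.of S (F.obj X ⧸ N) => g.hom y) h0
  exact ⟨hN' ▸ Submodule.fg_span (t.finite_toSet.image η)⟩

/-- Nakayama's lemma for the extension of scalars `F` along `p`: if `F.obj X = 0`, then `X` is
spanned by the products `r • x` with `p r = 0`, because `X` modulo their span is an `S`-module. -/
theorem isZero_of_isZero_leftAdjoint (p : R →+* S) (i : S →+* R) (hpi : p.comp i = RingHom.id S)
    (hnil : ∀ (X : Type u) [AddCommGroup X] [Module R X],
      Submodule.span R {y : X | ∃ r x, p r = 0 ∧ y = r • x} = ⊤ → Subsingleton X)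
    {F : ModuleCat.{u} R ⥤ ModuleCat.{u} S}
    (adj : F ⊣ ModuleCat.restrictScalars.{u} p) (X : ModuleCat.{u} R) (hX : IsZero (F.obj X)) :
    IsZero X := by
  let N : Submodule R X := Submodule.span R {y : X | ∃ r x, p r = 0 ∧ y = r • x}
  let Y : ModuleCat.{u} S := (ModuleCat.restrictScalars i).obj (ModuleCat.of R (X ⧸ N))
  have hpi' : ∀ s, p (i s) = s := fun s => RingHom.congr_fun hpi s
  have hkill : ∀ (r : R) (x : X), N.mkQ (i (p r) • x) = N.mkQ (r • x) := by
    intro r x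
    rw [← sub_eq_zero, ← map_sub, ← sub_smul]
    exact (Submodule.Quotient.mk_eq_zero N).2 (Submodule.subset_span
      ⟨_, x, by rw [map_sub, hpi', sub_self], rfl⟩)
  let g : X ⟶ (ModuleCat.restrictScalars p).obj Y := ModuleCat.ofHom
    (X := X) (Y := (ModuleCat.restrictScalars p).obj Y)
    { toFun := fun x => N.mkQ x
      map_add' := fun x y => map_add N.mkQ x y
      map_smul' := fun r x => (hkill r x).symm }
  have hg : g = 0 := by
    apply (adj.homEquiv X Y).symm.injective
    exact hX.eq_of_src _ _
  have hN : N = ⊤ := Submodule.eq_top_iff'.2 fun x => (Submodule.Quotient.mk_eq_zero N).1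
    (congrArg (fun g : X ⟶ (ModuleCat.restrictScalars p).obj Y => g.hom x) hg)
  have := hnil X hN
  exact ModuleCat.isZero_of_subsingleton X

/-- Restriction along a section `i` of `p` is a left inverse of the restriction along `p`. -/
def restrictScalarsCompIso (p : R →+* S) (i : S →+* R) (hpi : p.comp i = RingHom.id S) :
    ModuleCat.restrictScalars.{u} p ⋙ ModuleCat.restrictScalars.{u} i ≅ 𝟭 _ :=
  (ModuleCat.restrictScalarsComp' i p _ rfl).symm ≪≫ ModuleCat.restrictScalarsId' _ hpi

theorem hasProjectiveDimensionLT_of_restrictScalars (p : R →+* S) (i : S →+* R)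
    (hpi : p.comp i = RingHom.id S) {Y : ModuleCat.{u} S} {n : ℕ}
    (h : HasProjectiveDimensionLT ((ModuleCat.restrictScalars p).obj Y) n) :
    HasProjectiveDimensionLT Y n :=
  hasProjectiveDimensionLT_of_retract.{u} _ _ (restrictScalarsCompIso p i hpi) h

/-- The sequence `0 → K → R → S → 0` of `R`-modules, where `K` is isomorphic to the kernel of `p`.
-/
def regularKernelSequence (p : R →+* S) {K : ModuleCat.{u} R} (j : K →ₗ[R] R)
    (hj : ∀ r, p r = 0 ↔ r ∈ Set.range j) : ShortComplex (ModuleCat.{u} R) :=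
  ShortComplex.mk (ModuleCat.ofHom j : K ⟶ ModuleCat.of R R)
    (ModuleCat.ofHom (X := ModuleCat.of R R)
      (Y := (ModuleCat.restrictScalars p).obj (ModuleCat.of S S))
      { toFun := p, map_add' := map_add p, map_smul' := map_mul p }) (by
        ext x
        exact (hj _).2 ⟨x, rfl⟩)

theorem shortExact_regularKernelSequence (p : R →+* S) (hp : Function.Surjective p)
    {K : ModuleCat.{u} R} (j : K →ₗ[R] R) (hinj : Function.Injective j)
    (hj : ∀ r, p r = 0 ↔ r ∈ Set.range j) : (regularKernelSequence p j hj).ShortExact where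
  exact := (ShortComplex.ShortExact.moduleCat_exact_iff_function_exact _).2 hj
  mono_f := (ModuleCat.mono_iff_injective _).2 hinj
  epi_g := (ModuleCat.epi_iff_surjective _).2 hp

variable (R) in
theorem projective_regular : Projective (ModuleCat.of R R) :=
  (IsProjective.iff_projective (R := R) R).1 inferInstance

theorem hasProjectiveDimensionLT_restrictScalars_regular (p : R →+* S)
    (hp : Function.Surjective p)
    {K : ModuleCat.{u} R} (j : K →ₗ[R] R) (hinj : Function.Injective j)
    (hj : ∀ r, p r = 0 ↔ r ∈ Set.range j) {n : ℕ} (hK : HasProjectiveDimensionLT K n) :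
    HasProjectiveDimensionLT ((ModuleCat.restrictScalars p).obj (ModuleCat.of S S)) (n + 1) :=
  (shortExact_regularKernelSequence p hp j hinj hj).hasProjectiveDimensionLT_X₃ n hK
    (have := projective_regular R
     (inferInstance : HasProjectiveDimensionLT (ModuleCat.of R R) (n + 1)))

/-- If the kernel `K` of `p : R → S` is annihilated by itself, it is an `S`-module restricted along
`p`. Then its restriction along the section `i` has finite projective dimension, too, and so has the
`S`-module `R`, as an extension of `S` by this restriction. -/
theorem hasProjectiveDimensionLT_restrictScalars_section (p : R →+* S) (i : S →+* R)
    (hpi : p.comp i = RingHom.id S)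
    {K : ModuleCat.{u} R} (j : K →ₗ[R] R) (hinj : Function.Injective j)
    (hj : ∀ r, p r = 0 ↔ r ∈ Set.range j) (hkill : ∀ r, p r = 0 → ∀ x : K, r • x = 0)
    {n : ℕ} (hK : HasProjectiveDimensionLT K n) :
    HasProjectiveDimensionLT ((ModuleCat.restrictScalars i).obj (ModuleCat.of R R)) (n + 1) := by
  have hpi' : ∀ s, p (i s) = s := fun s => RingHom.congr_fun hpi s
  have hp : Function.Surjective p := fun s => ⟨i s, hpi' s⟩
  let e : K ≅ (ModuleCat.restrictScalars p).obj ((ModuleCat.restrictScalars i).obj K) :=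
    isoRestrictScalars p (Y := (ModuleCat.restrictScalars i).obj K) (AddEquiv.refl K)
      fun r x => by
        change r • x = i (p r) • x
        rw [← sub_eq_zero, ← sub_smul]
        exact hkill _ (by rw [map_sub, hpi', sub_self]) x
  have hiK : HasProjectiveDimensionLT ((ModuleCat.restrictScalars i).obj K) n :=
    hasProjectiveDimensionLT_of_restrictScalars p i hpi (hasProjectiveDimensionLT_of_iso e n)
  have hT := (shortExact_regularKernelSequence p hp j hinj hj).map_of_exact
    (ModuleCat.restrictScalars.{u} i)
  have hS : Projective ((ModuleCat.restrictScalars i).obj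
      ((ModuleCat.restrictScalars p).obj (ModuleCat.of S S))) :=
    Projective.of_iso ((restrictScalarsCompIso p i hpi).symm.app _) (projective_regular S)
  exact hT.hasProjectiveDimensionLT_X₂ (n + 1) (hiK.mono n.le_succ)
    (inferInstanceAs (HasProjectiveDimensionLT ((ModuleCat.restrictScalars i).obj
      ((ModuleCat.restrictScalars p).obj (ModuleCat.of S S))) (n + 1)))

theorem hasInjectiveDimensionLT_restrictScalars_ringDual (f : R →+* S) {n : ℕ}
    (h : HasProjectiveDimensionLT
      ((ModuleCat.restrictScalars (RingHom.op f)).obj (ModuleCat.of Sᵐᵒᵖ Sᵐᵒᵖ)) n) :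
    HasInjectiveDimensionLT ((ModuleCat.restrictScalars f).obj (ringDual S)) n := by
  let e₁ : ModuleCat.of Sᵐᵒᵖ Sᵐᵒᵖ ≅ ModuleCat.of Sᵐᵒᵖ S :=
    LinearEquiv.toModuleIso (MulOpposite.opLinearEquiv Sᵐᵒᵖ : S ≃ₗ[Sᵐᵒᵖ] Sᵐᵒᵖ).symm
  have h1 := hasProjectiveDimensionLT_of_iso
    ((ModuleCat.restrictScalars (RingHom.op f)).mapIso e₁) n
  have h2 := hasInjectiveDimensionLT_rightDual _ h1
  let e₂ : ModuleCat.of R (RightDual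
      ((ModuleCat.restrictScalars (RingHom.op f)).obj (ModuleCat.of Sᵐᵒᵖ S))) ≅
      (ModuleCat.restrictScalars f).obj (ringDual S) :=
    isoRestrictScalars f (Y := ringDual S) (AddEquiv.refl (RightDual S)) fun _ _ => rfl
  exact hasInjectiveDimensionLT_of_iso e₂ n

theorem hasProjectiveDimensionLT_finsupp (M : ModuleCat.{u} R) {n : ℕ}
    (h : HasProjectiveDimensionLT M n) (ι : Type u) :
    HasProjectiveDimensionLT (ModuleCat.of R (ι →₀ M)) n := by
  induction n generalizing M with
  | zero =>
    have := ModuleCat.subsingleton_of_isZero (isZero_of_hasProjectiveDimensionLT_zero M)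
    have : Subsingleton (ι →₀ M) := inferInstance
    exact IsZero.hasProjectiveDimensionLT_zero
      (ModuleCat.isZero_of_subsingleton (ModuleCat.of R (ι →₀ M)))
  | succ n ih =>
    have hproj : ∀ M : ModuleCat.{u} R, Projective M →
        HasProjectiveDimensionLT (ModuleCat.of R (ι →₀ M)) (n + 1) := fun M hM => by
      classical
      have := (IsProjective.iff_projective M).2 hM
      have : Projective (ModuleCat.of R (ι →₀ M)) :=
        (IsProjective.iff_projective (R := R) (ι →₀ M)).1
          (Module.Projective.of_equiv (finsuppLequivDFinsupp R (ι := ι) (M := M)).symm)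
      infer_instance
    obtain _ | n := n
    · exact hproj M (projective_iff_hasProjectiveDimensionLT_one.2 h)
    · let T := M.projectiveShortComplex
      have hT : T.ShortExact := M.shortExact_projectiveShortComplex
      have hT₂ : Projective T.X₂ := inferInstance
      have h1 := (hT.hasProjectiveDimensionLT_X₃_iff n hT₂).1 h
      have hinj : Function.Injective T.f.hom := (ModuleCat.mono_iff_injective _).1 hT.mono_f
      have hsurj : Function.Surjective T.g.hom := (ModuleCat.epi_iff_surjective _).1 hT.epi_g
      have hex : Function.Exact T.f.hom T.g.hom :=
        (ShortComplex.ShortExact.moduleCat_exact_iff_function_exact _).1 hT.exact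
      have hex' : Function.Exact (Finsupp.mapRange.linearMap (α := ι) T.f.hom)
          (Finsupp.mapRange.linearMap (α := ι) T.g.hom) := by
        rw [LinearMap.exact_iff, Finsupp.ker_mapRange, Finsupp.range_mapRange_linearMap,
          LinearMap.exact_iff.1 hex]
        exact LinearMap.ker_eq_bot.2 hinj
      let T' : ShortComplex (ModuleCat.{u} R) := ShortComplex.mk
        (ModuleCat.ofHom (Finsupp.mapRange.linearMap (α := ι) T.f.hom))
        (ModuleCat.ofHom (Finsupp.mapRange.linearMap (α := ι) T.g.hom))
        (ModuleCat.hom_ext hex'.linearMap_comp_eq_zero)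
      have hT' : T'.ShortExact :=
        { exact := (ShortComplex.ShortExact.moduleCat_exact_iff_function_exact _).2 hex'
          mono_f := (ModuleCat.mono_iff_injective _).2
            (Finsupp.mapRange_injective _ (map_zero _) hinj)
          epi_g := (ModuleCat.epi_iff_surjective _).2
            (Finsupp.mapRange_surjective _ (map_zero _) hsurj) }
      exact hT'.hasProjectiveDimensionLT_X₃ (n + 1) (ih _ h1) (hproj _ hT₂)

/-- Change of rings: projective dimensions grow by at most `d` under restriction along `p`, if `S`
has projective dimension less than `d` over `R`. -/
theorem hasProjectiveDimensionLT_restrictScalars (p : R →+* S) {d : ℕ}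
    (hd : HasProjectiveDimensionLT ((ModuleCat.restrictScalars p).obj (ModuleCat.of S S)) d)
    (Y : ModuleCat.{u} S) {n : ℕ} (h : HasProjectiveDimensionLT Y n) :
    HasProjectiveDimensionLT ((ModuleCat.restrictScalars p).obj Y) (d + n) := by
  have hfree : ∀ ι : Type u, HasProjectiveDimensionLT
      ((ModuleCat.restrictScalars p).obj (ModuleCat.of S (ι →₀ S))) d := fun ι => by
    have h0 := hasProjectiveDimensionLT_finsupp _ hd ι
    let e : ModuleCat.of R (ι →₀ (ModuleCat.restrictScalars p).obj (ModuleCat.of S S)) ≅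
        (ModuleCat.restrictScalars p).obj (ModuleCat.of S (ι →₀ S)) :=
      isoRestrictScalars p (Y := ModuleCat.of S (ι →₀ S)) (AddEquiv.refl (ι →₀ S)) fun _ _ => rfl
    exact hasProjectiveDimensionLT_of_iso e d
  induction n generalizing Y with
  | zero =>
    exact IsZero.hasProjectiveDimensionLT_zero (Functor.map_isZero _
      (isZero_of_hasProjectiveDimensionLT_zero Y)) |>.mono (Nat.zero_le _)
  | succ n ih =>
    let g : ModuleCat.of S (Y →₀ S) ⟶ Y := ModuleCat.ofHom (Finsupp.linearCombination S id)
    have hg : Epi g := (ModuleCat.epi_iff_surjective _).2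
      (Finsupp.linearCombination_id_surjective S Y)
    obtain _ | n := n
    · have hY : Projective Y := projective_iff_hasProjectiveDimensionLT_one.2 h
      let ρ : Retract Y (ModuleCat.of S (Y →₀ S)) :=
        ⟨Projective.factorThru (𝟙 Y) g, g, Projective.factorThru_comp _ _⟩
      have := hfree Y
      exact ((ρ.map (ModuleCat.restrictScalars p)).hasProjectiveDimensionLT d).mono
        (Nat.le_add_right _ _)
    · let T := ShortComplex.mk _ _ (kernel.condition g)
      have hT : T.ShortExact := { exact := ShortComplex.exact_kernel g }
      have hT₂ : Projective T.X₂ :=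
        (IsProjective.iff_projective (R := S) (Y →₀ S)).1 inferInstance
      have h1 := (hT.hasProjectiveDimensionLT_X₃_iff n hT₂).1 h
      exact (hT.map_of_exact (ModuleCat.restrictScalars.{u} p)).hasProjectiveDimensionLT_X₃
        (d + (n + 1)) (ih _ h1) ((hfree Y).mono (by lia))

end ChangeOfRings

/-! ### Homological dimensions as bounds -/

section Dimensions

theorem WithBot.lt_top_iff_exists_le {x : WithBot ℕ∞} : x < ⊤ ↔ ∃ n : ℕ, x ≤ n := by
  constructor
  · intro h
    induction x with
    | bot => exact ⟨0, bot_le⟩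
    | coe x =>
      induction x with
      | top => exact absurd h (lt_irrefl _)
      | coe n => exact ⟨n, le_rfl⟩
  · rintro ⟨n, hn⟩
    exact hn.trans_lt (WithBot.coe_lt_coe.2 (ENat.natCast_lt_top n))

variable {R S : Type u} [Ring R] [Ring S]

/-- The module `M` has finite projective dimension. -/
def HasFiniteProjDim (M : ModuleCat.{u} R) : Prop := ∃ n, HasProjectiveDimensionLT M n

theorem projectiveDimension_lt_top_iff (M : ModuleCat.{u} R) :
    projectiveDimension M < ⊤ ↔ HasFiniteProjDim M := by
  rw [lt_top_iff_ne_top, projectiveDimension_ne_top_iff]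
  exact ⟨fun ⟨n, hn⟩ => ⟨n + 1, hn⟩, fun ⟨n, hn⟩ => ⟨n, hn.mono n.le_succ⟩⟩

theorem hasBoundedProjDim_iff {P : ModuleCat.{u} R → Prop} :
    HasBoundedProjDim P ↔ ∃ n : ℕ, ∀ M, P M → projectiveDimension M ≤ n := by
  simp only [projectiveDimension_le_iff]
  exact ⟨fun ⟨n, hn⟩ => ⟨n, fun M hM => (hn M hM).mono n.le_succ⟩, fun ⟨n, hn⟩ => ⟨n + 1, hn⟩⟩

theorem littleFinitisticDim_lt_top_iff : littleFinitisticDim R < ⊤ ↔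
    HasBoundedProjDim fun M : ModuleCat.{u} R => Module.Finite R M ∧ HasFiniteProjDim M := by
  simp only [littleFinitisticDim, projectiveDimension_lt_top_iff]
  simp only [WithBot.lt_top_iff_exists_le, hasBoundedProjDim_iff, iSup_le_iff, and_imp]

theorem bigFinitisticDim_lt_top_iff : bigFinitisticDim R < ⊤ ↔
    HasBoundedProjDim fun M : ModuleCat.{u} R => HasFiniteProjDim M := by
  simp only [bigFinitisticDim, projectiveDimension_lt_top_iff]
  simp only [WithBot.lt_top_iff_exists_le, hasBoundedProjDim_iff, iSup_le_iff]

theorem globalDim_lt_top_iff : globalDim R < ⊤ ↔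
    HasBoundedProjDim fun _ : ModuleCat.{u} R => True := by
  simp only [globalDim, WithBot.lt_top_iff_exists_le, hasBoundedProjDim_iff, iSup_le_iff,
    true_imp_iff]

theorem HasFiniteProjDim.syzygy {T : ShortComplex (ModuleCat.{u} R)} (hT : T.ShortExact)
    (hT₂ : Projective T.X₂) (h : HasFiniteProjDim T.X₃) : HasFiniteProjDim T.X₁ := by
  obtain ⟨n, hn⟩ := h
  exact ⟨n + 1, hT.hasProjectiveDimensionLT_X₁ (n + 1) inferInstance (hn.mono (by lia))⟩

variable (R) in
theorem isSyzygyClosed_true : IsSyzygyClosed fun _ : ModuleCat.{u} R => True := fun M _ =>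
  ⟨M.projectiveShortComplex, M.shortExact_projectiveShortComplex, inferInstance, rfl, trivial⟩

variable (R) in
theorem isSyzygyClosed_hasFiniteProjDim :
    IsSyzygyClosed fun M : ModuleCat.{u} R => HasFiniteProjDim M := fun M hM =>
  ⟨M.projectiveShortComplex, M.shortExact_projectiveShortComplex, inferInstance, rfl,
    HasFiniteProjDim.syzygy M.shortExact_projectiveShortComplex inferInstance hM⟩

variable (R) in
theorem isSyzygyClosed_finite_and_hasFiniteProjDim [IsNoetherianRing R] :
    IsSyzygyClosed fun M : ModuleCat.{u} R => Module.Finite R M ∧ HasFiniteProjDim M := by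
  rintro M ⟨hM, hM'⟩
  obtain ⟨n, f, hf⟩ := Module.Finite.exists_fin' R M
  let T := f.shortComplexKer
  have hT : T.ShortExact := LinearMap.shortExact_shortComplexKer hf
  have hT₂ : Projective T.X₂ := (IsProjective.iff_projective (R := R) (Fin n → R)).1 inferInstance
  exact ⟨T, hT, hT₂, rfl, inferInstanceAs (Module.Finite R (LinearMap.ker f)), hM'.syzygy hT hT₂⟩

end Dimensions

/-! ### Cleft extensions of rings -/

section Transfer

variable {R S : Type u} [Ring R] [Ring S]

/-- Extension of scalars along a homomorphism of noncommutative rings, as a left adjoint of the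
restriction of scalars. -/
def extendScalarsAlong (f : R →+* S) : ModuleCat.{u} R ⥤ ModuleCat.{u} S :=
  have := restrictScalars_isRightAdjoint f
  (ModuleCat.restrictScalars.{u} f).leftAdjoint

/-- The adjunction defining `extendScalarsAlong`. -/
def extendScalarsAlongAdj (f : R →+* S) :
    extendScalarsAlong f ⊣ ModuleCat.restrictScalars.{u} f :=
  have := restrictScalars_isRightAdjoint f
  Adjunction.ofIsRightAdjoint _

instance (f : R →+* S) : (extendScalarsAlong f).Additive :=
  (extendScalarsAlongAdj f).left_adjoint_additive

/-- Extension of scalars along `f` reflects projectivity of modules orthogonal to the restricted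
dual of `S`. As `Ext X (ringDual S)` is the dual of `Tor S X`, these are the modules that are
acyclic for the extension of scalars. -/
def ReflectsProjectives (f : R →+* S) : Prop :=
  ∀ X : ModuleCat.{u} R, ExtOrthogonal X ((ModuleCat.restrictScalars f).obj (ringDual S)) 0 →
    Projective ((extendScalarsAlong f).obj X) → Projective X

/-- Extension of scalars along `f` makes sense on high syzygies without higher derived functors,
since the restricted dual of `S` has finite injective dimension, and there it reflects projectivity.
This is what is needed to bound projective dimensions over `R` by those over `S`. -/
structure HasSyzygyTransfer (f : R →+* S) : Prop where
  reflects : ReflectsProjectives f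
  hasInjectiveDimensionLT :
    ∃ n, HasInjectiveDimensionLT ((ModuleCat.restrictScalars f).obj (ringDual S)) n

namespace HasSyzygyTransfer

variable {f : R →+* S} (hf : HasSyzygyTransfer f)
include hf

theorem hasBoundedProjDim {P : ModuleCat.{u} R → Prop} {P' : ModuleCat.{u} S → Prop}
    (hP : IsSyzygyClosed P)
    (hPP' : ∀ X, ExtOrthogonal X ((ModuleCat.restrictScalars f).obj (ringDual S)) 0 → P X →
      P' ((extendScalarsAlong f).obj X)) (h : HasBoundedProjDim P') : HasBoundedProjDim P := by
  obtain ⟨n, hn⟩ := hf.hasInjectiveDimensionLT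
  exact hasBoundedProjDim_of_adjunction (extendScalarsAlongAdj f) (isCogenerator_ringDual S)
    hf.reflects hn hP hPP' h

omit hf in
theorem hasFiniteProjDim_extendScalars (X : ModuleCat.{u} R)
    (hX : ExtOrthogonal X ((ModuleCat.restrictScalars f).obj (ringDual S)) 0)
    (h : HasFiniteProjDim X) : HasFiniteProjDim ((extendScalarsAlong f).obj X) := by
  obtain ⟨n, hn⟩ := h
  exact ⟨n, hasProjectiveDimensionLT_map (extendScalarsAlongAdj f) (isCogenerator_ringDual S)
    hX hn⟩

theorem littleFinitisticDim_lt_top [IsNoetherianRing R] (h : littleFinitisticDim S < ⊤) :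
    littleFinitisticDim R < ⊤ := by
  rw [littleFinitisticDim_lt_top_iff] at h ⊢
  refine hf.hasBoundedProjDim (isSyzygyClosed_finite_and_hasFiniteProjDim R)
    (fun X hX hX' => ⟨?_, hasFiniteProjDim_extendScalars X hX hX'.2⟩) h
  have := hX'.1
  exact finite_leftAdjoint f (extendScalarsAlongAdj f) X

theorem bigFinitisticDim_lt_top (h : bigFinitisticDim S < ⊤) : bigFinitisticDim R < ⊤ := by
  rw [bigFinitisticDim_lt_top_iff] at h ⊢
  exact hf.hasBoundedProjDim (isSyzygyClosed_hasFiniteProjDim R) hasFiniteProjDim_extendScalars h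

theorem globalDim_lt_top (h : globalDim S < ⊤) : globalDim R < ⊤ := by
  rw [globalDim_lt_top_iff] at h ⊢
  exact hf.hasBoundedProjDim (isSyzygyClosed_true R) (fun _ _ _ => trivial) h

end HasSyzygyTransfer

section Cleft

variable (p : R →+* S) (i : S →+* R) (hpi : p.comp i = RingHom.id S)
include hpi

/-- The projection `p` transfers bounds from `S` to `R`, provided that its kernel is nilpotent (in
the form of Nakayama's lemma) and has finite projective dimension as a right module. -/
theorem hasSyzygyTransfer_projection
    (hnil : ∀ (X : Type u) [AddCommGroup X] [Module R X],
      Submodule.span R {y : X | ∃ r x, p r = 0 ∧ y = r • x} = ⊤ → Subsingleton X)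
    {K : ModuleCat.{u} Rᵐᵒᵖ} (j : K →ₗ[Rᵐᵒᵖ] Rᵐᵒᵖ) (hinj : Function.Injective j)
    (hj : ∀ r, p.op r = 0 ↔ r ∈ Set.range j) (hK : HasFiniteProjDim K) :
    HasSyzygyTransfer p where
  reflects X hX h := by
    have hp : Function.Surjective p := fun s => ⟨i s, RingHom.congr_fun hpi s⟩
    have : (ModuleCat.restrictScalars.{u} p).Full := by
      refine ⟨fun {X Y} g => ⟨ModuleCat.ofHom { g.hom.toAddMonoidHom with map_smul' := ?_ }, rfl⟩⟩
      intro s x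
      obtain ⟨r, rfl⟩ := hp s
      exact g.hom.map_smul r x
    exact projective_of_projective_map (extendScalarsAlongAdj p) (extendScalarsAlongAdj i)
      (restrictScalarsCompIso p i hpi)
      (isZero_of_isZero_leftAdjoint p i hpi hnil (extendScalarsAlongAdj p))
      (isCogenerator_ringDual S) hX h
  hasInjectiveDimensionLT := by
    obtain ⟨n, hn⟩ := hK
    have hp : Function.Surjective p.op := fun s =>
      ⟨.op (i s.unop), MulOpposite.unop_injective (RingHom.congr_fun hpi s.unop)⟩
    exact ⟨n + 1, hasInjectiveDimensionLT_restrictScalars_ringDual p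
      (hasProjectiveDimensionLT_restrictScalars_regular p.op hp j hinj hj hn)⟩

/-- The section `i` transfers bounds from `R` to `S`, provided that the kernel of `p` has square
zero and finite projective dimension as a right module. -/
theorem hasSyzygyTransfer_section
    {K : ModuleCat.{u} Rᵐᵒᵖ} (j : K →ₗ[Rᵐᵒᵖ] Rᵐᵒᵖ) (hinj : Function.Injective j)
    (hj : ∀ r, p.op r = 0 ↔ r ∈ Set.range j) (hkill : ∀ r, p.op r = 0 → ∀ x : K, r • x = 0)
    (hK : HasFiniteProjDim K) : HasSyzygyTransfer i where
  reflects X _ h := projective_of_projective_leftAdjoint (extendScalarsAlongAdj p)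
    (extendScalarsAlongAdj i) (restrictScalarsCompIso p i hpi) h
  hasInjectiveDimensionLT := by
    obtain ⟨n, hn⟩ := hK
    have hpi' : p.op.comp i.op = RingHom.id _ :=
      RingHom.ext fun s => MulOpposite.unop_injective (RingHom.congr_fun hpi s.unop)
    exact ⟨n + 1, hasInjectiveDimensionLT_restrictScalars_ringDual i
      (hasProjectiveDimensionLT_restrictScalars_section p.op i.op hpi' j hinj hj hkill hn)⟩

theorem hasBoundedProjDim_of_restrictScalars {P : ModuleCat.{u} R → Prop}
    {P' : ModuleCat.{u} S → Prop} (h : ∀ Y, P' Y → P ((ModuleCat.restrictScalars p).obj Y))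
    (hP : HasBoundedProjDim P) : HasBoundedProjDim P' := by
  obtain ⟨n, hn⟩ := hP
  exact ⟨n, fun Y hY => hasProjectiveDimensionLT_of_restrictScalars p i hpi (hn _ (h Y hY))⟩

/-- This needs no assumption on the kernel of `p`: projective dimensions over `S` are bounded by
those of the restricted `R`-modules. -/
theorem globalDim_lt_top_of_section (h : globalDim R < ⊤) : globalDim S < ⊤ := by
  rw [globalDim_lt_top_iff] at h ⊢
  exact hasBoundedProjDim_of_restrictScalars p i hpi (fun _ _ => trivial) h

variable {K : ModuleCat.{u} R} (j : K →ₗ[R] R) (hinj : Function.Injective j)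
    (hj : ∀ r, p r = 0 ↔ r ∈ Set.range j) (hK : HasFiniteProjDim K)
include hinj hj hK

/-- If the kernel of `p` has finite projective dimension as a left module, then restriction along
`p` preserves finiteness of projective dimensions. -/
theorem hasFiniteProjDim_restrictScalars (Y : ModuleCat.{u} S) (hY : HasFiniteProjDim Y) :
    HasFiniteProjDim ((ModuleCat.restrictScalars p).obj Y) := by
  have hp : Function.Surjective p := fun s => ⟨i s, RingHom.congr_fun hpi s⟩
  obtain ⟨n, hn⟩ := hK
  obtain ⟨m, hm⟩ := hY
  exact ⟨_, hasProjectiveDimensionLT_restrictScalars p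
    (hasProjectiveDimensionLT_restrictScalars_regular p hp j hinj hj hn) Y hm⟩

theorem bigFinitisticDim_lt_top_of_section (h : bigFinitisticDim R < ⊤) :
    bigFinitisticDim S < ⊤ := by
  rw [bigFinitisticDim_lt_top_iff] at h ⊢
  exact hasBoundedProjDim_of_restrictScalars p i hpi
    (hasFiniteProjDim_restrictScalars p i hpi j hinj hj hK) h

theorem littleFinitisticDim_lt_top_of_section (h : littleFinitisticDim R < ⊤) :
    littleFinitisticDim S < ⊤ := by
  rw [littleFinitisticDim_lt_top_iff] at h ⊢
  refine hasBoundedProjDim_of_restrictScalars p i hpi (fun Y hY => ⟨?_,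
    hasFiniteProjDim_restrictScalars p i hpi j hinj hj hK Y hY.2⟩) h
  have hp : Function.Surjective p := fun s => ⟨i s, RingHom.congr_fun hpi s⟩
  obtain ⟨t, ht⟩ := hY.1.fg_top
  let Y' : ModuleCat.{u} R := (ModuleCat.restrictScalars p).obj Y
  let N : Submodule R Y' := Submodule.span R (t : Set Y)
  have key : ∀ y : Y, y ∈ Submodule.span S (t : Set Y) → @Membership.mem Y' _ _ N y :=
      fun y hy => by
    induction hy using Submodule.span_induction with
    | mem x hx => exact Submodule.subset_span hx
    | zero => exact N.zero_mem
    | add x y _ _ hx hy => exact N.add_mem hx hy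
    | smul s x _ hx =>
      obtain ⟨r, rfl⟩ := hp s
      exact N.smul_mem r hx
  exact ⟨⟨t, Submodule.eq_top_iff'.2 fun y => key y (ht ▸ Submodule.mem_top)⟩⟩

end Cleft

end Transfer

/-! ### Paths avoiding a set of arrows -/

section Paths

variable {k : Type u} {V : Type v} [Field k] [Quiver.{w} V]

theorem not_passesThrough_nil (A : Set (Quiver.Total V)) (a : V) :
    ¬ PassesThrough A (⟨a, a, Quiver.Path.nil⟩ : AnyPath V) := by
  rintro ⟨α, -, p₁, p₂, h⟩
  have := congrArg Quiver.Path.length h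
  simp only [Quiver.Path.length_nil, Quiver.Path.length_comp, Quiver.Path.length_cons] at this
  lia

theorem passesThrough_cons_iff (A : Set (Quiver.Total V)) {a b c : V} (p : Quiver.Path a b)
    (e : b ⟶ c) : PassesThrough A (⟨a, c, p.cons e⟩ : AnyPath V) ↔
      PassesThrough A (⟨a, b, p⟩ : AnyPath V) ∨ (⟨b, c, e⟩ : Quiver.Total V) ∈ A := by
  constructor
  · rintro ⟨⟨l, r, f⟩, hα, p₁, p₂, h⟩
    dsimp only at p₁ p₂ h
    cases p₂ with
    | nil =>
      rw [Quiver.Path.comp_nil] at h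
      cases h
      exact Or.inr hα
    | cons p₂ e' =>
      rw [Quiver.Path.comp_cons] at h
      cases h
      exact Or.inl ⟨_, hα, p₁, p₂, rfl⟩
  · rintro (⟨α, hα, p₁, p₂, h⟩ | he)
    · dsimp only at p₁ p₂ h
      exact ⟨α, hα, p₁, p₂.cons e, by rw [Quiver.Path.comp_cons, ← h]⟩
    · exact ⟨_, he, p, Quiver.Path.nil, rfl⟩

theorem passesThrough_comp_iff (A : Set (Quiver.Total V)) {a b c : V} (p : Quiver.Path a b)
    (q : Quiver.Path b c) : PassesThrough A (⟨a, c, p.comp q⟩ : AnyPath V) ↔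
      PassesThrough A (⟨a, b, p⟩ : AnyPath V) ∨ PassesThrough A (⟨b, c, q⟩ : AnyPath V) := by
  induction q with
  | nil => simp [not_passesThrough_nil]
  | cons q e ih =>
    rw [Quiver.Path.comp_cons, passesThrough_cons_iff, passesThrough_cons_iff, ih, or_assoc]

/-- In a finite quiver, there are finitely many paths of bounded length. -/
theorem finite_setOf_length_lt [Finite V] [∀ a b : V, Finite (a ⟶ b)] (n : ℕ) :
    {p : AnyPath V | p.2.2.length < n}.Finite := by
  induction n with
  | zero => simp
  | succ n ih =>
    refine Set.Finite.subset (s := Set.range (fun a : V => (⟨a, a, Quiver.Path.nil⟩ : AnyPath V)) ∪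
      ⋃ p ∈ {p : AnyPath V | p.2.2.length < n}, ⋃ c : V,
        Set.range (fun e : p.2.1 ⟶ c => (⟨p.1, c, p.2.2.cons e⟩ : AnyPath V)))
      ((Set.finite_range _).union (ih.biUnion fun p _ => Set.finite_iUnion fun c =>
        Set.finite_range _)) ?_
    rintro ⟨a, b, p⟩ hp
    cases p with
    | nil => exact Or.inl ⟨a, rfl⟩
    | cons p e =>
      refine Or.inr ?_
      simp only [Set.mem_iUnion]
      exact ⟨⟨a, _, p⟩, Nat.lt_of_succ_lt_succ hp, b, e, rfl⟩

namespace PathAlgebra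

open Classical in
theorem avoiding_ofPath_of_passesThrough {A : Set (Quiver.Total V)} {p : AnyPath V}
    (hp : PassesThrough A p) : avoiding A (ofPath k p) = 0 :=
  Finsupp.filter_single_of_neg _ (not_not.2 hp)

open Classical in
theorem avoiding_ofPath_of_not_passesThrough {A : Set (Quiver.Total V)} {p : AnyPath V}
    (hp : ¬ PassesThrough A p) : avoiding A (ofPath k p) = ofPath k p :=
  Finsupp.filter_single_of_pos _ hp

open Classical in
theorem avoiding_zero (A : Set (Quiver.Total V)) : avoiding A (0 : PathAlgebra k V) = 0 :=
  Finsupp.filter_zero _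

open Classical in
theorem avoiding_add (A : Set (Quiver.Total V)) (x y : PathAlgebra k V) :
    avoiding A (x + y) = avoiding A x + avoiding A y :=
  Finsupp.filter_add

open Classical in
theorem avoiding_smul (A : Set (Quiver.Total V)) (r : k) (x : PathAlgebra k V) :
    avoiding A (r • x) = r • avoiding A x :=
  Finsupp.filter_smul

theorem avoiding_ofPath_mul_ofPath (A : Set (Quiver.Total V)) (p q : AnyPath V) :
    avoiding A (ofPath k p * ofPath k q) = avoiding A (ofPath k p) * avoiding A (ofPath k q) := by
  obtain ⟨a, b, p⟩ := p
  obtain ⟨c, d, q⟩ := q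
  by_cases hp : PassesThrough A (⟨a, b, p⟩ : AnyPath V)
  · rw [avoiding_ofPath_of_passesThrough hp, zero_mul']
    by_cases h : b = c
    · subst h
      rw [ofPath_mul_ofPath_comp, avoiding_ofPath_of_passesThrough
        ((passesThrough_comp_iff A p q).2 (Or.inl hp))]
    · rw [ofPath_mul_ofPath_of_ne _ _ h, avoiding_zero]
  · rw [avoiding_ofPath_of_not_passesThrough hp]
    by_cases h : b = c
    · subst h
      rw [ofPath_mul_ofPath_comp]
      by_cases hq : PassesThrough A (⟨b, d, q⟩ : AnyPath V)
      · rw [avoiding_ofPath_of_passesThrough hq, mul_zero', avoiding_ofPath_of_passesThrough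
          ((passesThrough_comp_iff A p q).2 (Or.inr hq))]
      · rw [avoiding_ofPath_of_not_passesThrough hq, ofPath_mul_ofPath_comp,
          avoiding_ofPath_of_not_passesThrough fun h =>
            ((passesThrough_comp_iff A p q).1 h).elim hp hq]
    · rw [ofPath_mul_ofPath_of_ne _ _ h, avoiding_zero]
      by_cases hq : PassesThrough A (⟨c, d, q⟩ : AnyPath V)
      · rw [avoiding_ofPath_of_passesThrough hq, mul_zero']
      · rw [avoiding_ofPath_of_not_passesThrough hq, ofPath_mul_ofPath_of_ne _ _ h]

theorem avoiding_mul (A : Set (Quiver.Total V)) (x y : PathAlgebra k V) :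
    avoiding A (x * y) = avoiding A x * avoiding A y := by
  induction x using induction_path with
  | h0 => simp only [zero_mul', avoiding_zero]
  | hadd x₁ x₂ h₁ h₂ => simp only [add_mul', avoiding_add, h₁, h₂]
  | hpath r p =>
    induction y using induction_path with
    | h0 => simp only [mul_zero', avoiding_zero]
    | hadd y₁ y₂ h₁ h₂ => simp only [mul_add', avoiding_add, h₁, h₂]
    | hpath s q =>
      simp only [smul_mul', mul_smul', avoiding_smul, avoiding_ofPath_mul_ofPath]

theorem ofPath_cons {a b c : V} (p : Quiver.Path a b) (e : b ⟶ c) :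
    ofPath k (⟨a, c, p.cons e⟩ : AnyPath V) = ofPath k ⟨a, b, p⟩ * ofArrow k ⟨b, c, e⟩ :=
  (ofPath_mul_ofPath_comp p e.toPath).symm

variable [Fintype V]

theorem avoiding_one (A : Set (Quiver.Total V)) : avoiding A (1 : PathAlgebra k V) = 1 := by
  let f : PathAlgebra k V →+ PathAlgebra k V :=
    { toFun := avoiding A, map_zero' := avoiding_zero A, map_add' := avoiding_add A }
  change f 1 = 1
  rw [one_def, map_sum]
  exact Finset.sum_congr rfl fun a _ =>
    avoiding_ofPath_of_not_passesThrough (not_passesThrough_nil A a)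

variable (k) in
/-- Deleting the paths through `A` is a ring endomorphism of the path algebra, because a product of
two paths passes through `A` if and only if one of the factors does. -/
def avoidingHom (A : Set (Quiver.Total V)) : PathAlgebra k V →+* PathAlgebra k V where
  toFun := avoiding A
  map_zero' := avoiding_zero A
  map_one' := avoiding_one A
  map_add' := avoiding_add A
  map_mul' := avoiding_mul A

variable (k V) in
/-- The span of all paths of length at least `n`. -/
def lengthFiltration (n : ℕ) : Submodule k (PathAlgebra k V) :=
  Submodule.span k (ofPath k '' {p : AnyPath V | n ≤ p.2.2.length})

theorem mem_lengthFiltration_zero (x : PathAlgebra k V) : x ∈ lengthFiltration k V 0 := by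
  induction x using induction_path with
  | h0 => exact Submodule.zero_mem _
  | hadd x y hx hy => exact Submodule.add_mem _ hx hy
  | hpath r p => exact Submodule.smul_mem _ r (Submodule.subset_span ⟨p, Nat.zero_le _, rfl⟩)

theorem mul_mem_lengthFiltration {m n : ℕ} {x y : PathAlgebra k V}
    (hx : x ∈ lengthFiltration k V m) (hy : y ∈ lengthFiltration k V n) :
    x * y ∈ lengthFiltration k V (m + n) := by
  induction hx using Submodule.span_induction with
  | zero => rw [zero_mul]; exact Submodule.zero_mem _
  | add x x' _ _ hx hx' => rw [add_mul]; exact Submodule.add_mem _ hx hx'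
  | smul r x _ hx => rw [smul_mul']; exact Submodule.smul_mem _ r hx
  | mem x hx =>
    obtain ⟨⟨a, b, p⟩, hp, rfl⟩ := hx
    induction hy using Submodule.span_induction with
    | zero => rw [mul_zero]; exact Submodule.zero_mem _
    | add x x' _ _ hx hx' => rw [mul_add]; exact Submodule.add_mem _ hx hx'
    | smul r x _ hx => rw [mul_smul']; exact Submodule.smul_mem _ r hx
    | mem y hy =>
      obtain ⟨⟨c, d, q⟩, hq, rfl⟩ := hy
      by_cases h : b = c
      · subst h
        rw [ofPath_mul_ofPath_comp]
        refine Submodule.subset_span ⟨_, ?_, rfl⟩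
        change m + n ≤ (p.comp q).length
        rw [Quiver.Path.length_comp]
        exact Nat.add_le_add hp hq
      · rw [ofPath_mul_ofPath_of_ne _ _ h]
        exact Submodule.zero_mem _

theorem ofPath_mem_of_le_length {I : TwoSidedIdeal (PathAlgebra k V)} {N : ℕ}
    (hN : ∀ p : AnyPath V, p.2.2.length = N → ofPath k p ∈ I) (p : AnyPath V)
    (hp : N ≤ p.2.2.length) : ofPath k p ∈ I := by
  obtain ⟨a, b, p⟩ := p
  induction p with
  | nil =>
    refine hN _ ?_
    change N ≤ 0 at hp
    exact (Nat.le_zero.1 hp).symm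
  | cons p e ih =>
    obtain h | h := Nat.eq_or_lt_of_le hp
    · exact hN _ h.symm
    · rw [ofPath_cons]
      exact I.mul_mem_right _ _ (ih (Nat.le_of_lt_succ h))

theorem smul_mem {I : TwoSidedIdeal (PathAlgebra k V)} (r : k) {x : PathAlgebra k V}
    (hx : x ∈ I) : r • x ∈ I := by
  rw [← one_mul x, ← smul_mul']
  exact I.mul_mem_left _ _ hx

theorem mem_of_mem_lengthFiltration {I : TwoSidedIdeal (PathAlgebra k V)} {N : ℕ}
    (hN : ∀ p : AnyPath V, p.2.2.length = N → ofPath k p ∈ I) {x : PathAlgebra k V}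
    (hx : x ∈ lengthFiltration k V N) : x ∈ I := by
  induction hx using Submodule.span_induction with
  | zero => exact I.zero_mem
  | add x y _ _ hx hy => exact I.add_mem hx hy
  | smul r x _ hx => exact smul_mem r hx
  | mem x hx =>
    obtain ⟨p, hp, rfl⟩ := hx
    exact ofPath_mem_of_le_length hN p hp

end PathAlgebra

end Paths

/-! ### Bound quiver algebras -/

section BoundQuiverAlgebra

variable {k : Type u} {V : Type v} [Field k] [Quiver.{w} V] [Fintype V]
variable {I : TwoSidedIdeal (PathAlgebra k V)}

open PathAlgebra

theorem TwoSidedIdeal.mk'_eq_zero_iff {R : Type*} [Ring R] (I : TwoSidedIdeal R) (x : R) :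
    I.ringCon.mk' x = 0 ↔ x ∈ I := by
  rw [← TwoSidedIdeal.mem_ker, TwoSidedIdeal.ker_ringCon_mk']

theorem TwoSidedIdeal.ringCon_le_ker {R R' : Type*} [Ring R] [Ring R'] (I : TwoSidedIdeal R)
    (f : R →+* R') (h : ∀ x ∈ I, f x = 0) : I.ringCon ≤ RingCon.ker f := fun {x y} hxy => by
  have := h _ ((I.rel_iff x y).1 hxy)
  rwa [map_sub, sub_eq_zero] at this

/-- `k V / I` is finite-dimensional, spanned by the paths shorter than those contained in `I`. -/
theorem IsAdmissible.isNoetherianRing [∀ a b : V, Finite (a ⟶ b)] (hI : IsAdmissible I) :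
    IsNoetherianRing (QuiverAlgebra I) := by
  obtain ⟨-, N, -, hN⟩ := hI
  let f : PathAlgebra k V →ₗ[k] QuiverAlgebra I := (I.ringCon.mkₐ (α := k)).toLinearMap
  have hf : ∀ x, f x = I.ringCon.mk' x := fun _ => rfl
  have hfin : Module.Finite k (QuiverAlgebra I) := by
    refine ⟨⟨((finite_setOf_length_lt (V := V) N).image fun p => f (ofPath k p)).toFinset,
      Submodule.eq_top_iff'.2 fun y => ?_⟩⟩
    obtain ⟨x, rfl⟩ := I.ringCon.mk'_surjective y
    rw [Set.Finite.coe_toFinset, ← hf]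
    induction x using induction_path with
    | h0 => rw [map_zero]; exact Submodule.zero_mem _
    | hadd x y hx hy => rw [map_add]; exact Submodule.add_mem _ hx hy
    | hpath r p =>
      rw [map_smul]
      refine Submodule.smul_mem _ r ?_
      by_cases hp : p.2.2.length < N
      · exact Submodule.subset_span ⟨p, hp, rfl⟩
      · rw [hf, (I.mk'_eq_zero_iff _).2 (ofPath_mem_of_le_length hN p (not_lt.1 hp))]
        exact Submodule.zero_mem _
  exact isNoetherian_of_tower k inferInstance

theorem exists_lengthFiltration_of_mem_arrowIdeal {A : Set (Quiver.Total V)}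
    {x : QuiverAlgebra I} (hx : x ∈ arrowIdeal I A) :
    ∃ z ∈ lengthFiltration k V 1, I.ringCon.mk' z = x := by
  induction hx using TwoSidedIdeal.span_induction with
  | mem x hx =>
    obtain ⟨α, -, rfl⟩ := hx
    exact ⟨_, Submodule.subset_span ⟨_, Nat.le_refl 1, rfl⟩, rfl⟩
  | zero => exact ⟨0, Submodule.zero_mem _, map_zero _⟩
  | add x y _ _ hx hy =>
    obtain ⟨z, hz, rfl⟩ := hx
    obtain ⟨z', hz', rfl⟩ := hy
    exact ⟨z + z', Submodule.add_mem _ hz hz', map_add _ _ _⟩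
  | neg x _ hx =>
    obtain ⟨z, hz, rfl⟩ := hx
    exact ⟨-z, Submodule.neg_mem _ hz, map_neg _ _⟩
  | left_absorb a x _ hx =>
    obtain ⟨z, hz, rfl⟩ := hx
    obtain ⟨y, rfl⟩ := I.ringCon.mk'_surjective a
    exact ⟨y * z, by simpa using mul_mem_lengthFiltration (mem_lengthFiltration_zero y) hz,
      map_mul _ _ _⟩
  | right_absorb a x _ hx =>
    obtain ⟨z, hz, rfl⟩ := hx
    obtain ⟨y, rfl⟩ := I.ringCon.mk'_surjective a
    exact ⟨z * y, by simpa using mul_mem_lengthFiltration hz (mem_lengthFiltration_zero y),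
      map_mul _ _ _⟩

/-- Nakayama's lemma for the ideal generated by `A`, which is nilpotent. -/
theorem IsAdmissible.subsingleton_of_span_arrowIdeal_smul_eq_top (hI : IsAdmissible I)
    (A : Set (Quiver.Total V)) (X : Type*) [AddCommGroup X] [Module (QuiverAlgebra I) X]
    (hX : Submodule.span (QuiverAlgebra I)
      {y : X | ∃ r x, (arrowIdeal I A).ringCon.mk' r = 0 ∧ y = r • x} = ⊤) : Subsingleton X := by
  obtain ⟨-, N, -, hN⟩ := hI
  let M (n : ℕ) : Submodule (QuiverAlgebra I) X := Submodule.span (QuiverAlgebra I)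
    {y : X | ∃ z ∈ lengthFiltration k V n, ∃ x, y = I.ringCon.mk' z • x}
  have hstep : ∀ n (x : X), x ∈ M n → ∀ z ∈ lengthFiltration k V 1,
      I.ringCon.mk' z • x ∈ M (n + 1) := by
    intro n x hx
    induction hx using Submodule.span_induction with
    | zero => intro z _; rw [smul_zero]; exact Submodule.zero_mem _
    | add x y _ _ hx hy =>
      intro z hz
      rw [smul_add]
      exact Submodule.add_mem _ (hx z hz) (hy z hz)
    | smul r x _ hx =>
      intro z hz
      obtain ⟨y, rfl⟩ := I.ringCon.mk'_surjective r
      rw [← mul_smul, ← map_mul]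
      exact hx _ (by simpa using mul_mem_lengthFiltration hz (mem_lengthFiltration_zero y))
    | mem x hx =>
      intro z hz
      obtain ⟨w, hw, x, rfl⟩ := hx
      refine Submodule.subset_span ⟨z * w, ?_, x, by rw [← mul_smul, ← map_mul]⟩
      rw [Nat.add_comm]
      exact mul_mem_lengthFiltration hz hw
  have htop : ∀ n, M n = ⊤ := by
    intro n
    induction n with
    | zero =>
      exact Submodule.eq_top_iff'.2 fun x => Submodule.subset_span
        ⟨1, mem_lengthFiltration_zero 1, x, by rw [map_one, one_smul]⟩
    | succ n ih =>
      rw [eq_top_iff, ← hX, Submodule.span_le]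
      rintro _ ⟨r, x, hr, rfl⟩
      obtain ⟨z, hz, rfl⟩ := exists_lengthFiltration_of_mem_arrowIdeal
        (((arrowIdeal I A).mk'_eq_zero_iff r).1 hr)
      exact hstep n x (ih ▸ Submodule.mem_top) z hz
  have hbot : M N = ⊥ := by
    rw [Submodule.span_eq_bot]
    rintro _ ⟨z, hz, x, rfl⟩
    rw [(I.mk'_eq_zero_iff z).2 (mem_of_mem_lengthFiltration hN hz), zero_smul]
  exact (Submodule.subsingleton_iff _).1 (subsingleton_of_bot_eq_top (hbot.symm.trans (htop N)))

variable {A : Set (Quiver.Total V)}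

theorem ofPath_mem_arrowIdeal {p : AnyPath V} (hp : PassesThrough A p) :
    I.ringCon.mk' (ofPath k p) ∈ arrowIdeal I A := by
  obtain ⟨a, b, p⟩ := p
  obtain ⟨α, hα, p₁, p₂, h⟩ := hp
  dsimp only at p₁ p₂ h
  rw [h, ← ofPath_mul_ofPath_comp, ofPath_cons, map_mul, map_mul]
  exact TwoSidedIdeal.mul_mem_right _ _ _ (TwoSidedIdeal.mul_mem_left _ _ _
    (TwoSidedIdeal.subset_span ⟨α, hα, rfl⟩))

theorem sub_avoiding_mem_arrowIdeal (x : PathAlgebra k V) :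
    I.ringCon.mk' (x - avoiding A x) ∈ arrowIdeal I A := by
  induction x using induction_path with
  | h0 => rw [avoiding_zero, sub_zero, map_zero]; exact TwoSidedIdeal.zero_mem _
  | hadd x y hx hy =>
    rw [avoiding_add, add_sub_add_comm, map_add]
    exact TwoSidedIdeal.add_mem _ hx hy
  | hpath r p =>
    by_cases hp : PassesThrough A p
    · rw [avoiding_smul, avoiding_ofPath_of_passesThrough hp, smul_zero, sub_zero,
        ← one_mul (ofPath k p), ← PathAlgebra.smul_mul', map_mul]
      exact TwoSidedIdeal.mul_mem_left _ _ _ (ofPath_mem_arrowIdeal hp)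
    · rw [avoiding_smul, avoiding_ofPath_of_not_passesThrough hp, sub_self, map_zero]
      exact TwoSidedIdeal.zero_mem _

/-- For a pre-removable set `A`, deletion of the paths through `A` descends to a section of the
projection of `k V / I` onto its quotient by the ideal generated by `A`. -/
theorem IsPreRemovable.exists_section (hA : IsPreRemovable I A) :
    ∃ i : (arrowIdeal I A).ringCon.Quotient →+* QuiverAlgebra I,
      (arrowIdeal I A).ringCon.mk'.comp i = RingHom.id _ := by
  let ρ : QuiverAlgebra I →+* QuiverAlgebra I :=
    I.ringCon.lift (I.ringCon.mk'.comp (avoidingHom k A))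
      (I.ringCon_le_ker _ fun z hz => (I.mk'_eq_zero_iff _).2 (hA z hz).2)
  have hρ : ∀ x, ρ (I.ringCon.mk' x) = I.ringCon.mk' (avoiding A x) := fun _ => rfl
  have hle' : arrowIdeal I A ≤ TwoSidedIdeal.ker ρ := by
    refine TwoSidedIdeal.span_le.2 ?_
    rintro _ ⟨α, hα, rfl⟩
    refine (TwoSidedIdeal.mem_ker _).2 ?_
    rw [hρ, ofArrow, avoiding_ofPath_of_passesThrough, map_zero]
    exact ⟨α, hα, Quiver.Path.nil, Quiver.Path.nil, rfl⟩
  refine ⟨(arrowIdeal I A).ringCon.lift ρ (TwoSidedIdeal.ringCon_le_ker _ _ fun x hx =>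
    (TwoSidedIdeal.mem_ker _).1 (hle' hx)), ?_⟩
  refine RingHom.ext fun y => ?_
  obtain ⟨y, rfl⟩ := (arrowIdeal I A).ringCon.mk'_surjective y
  obtain ⟨x, rfl⟩ := I.ringCon.mk'_surjective y
  change (arrowIdeal I A).ringCon.mk' (I.ringCon.mk' (avoiding A x)) =
    (arrowIdeal I A).ringCon.mk' (I.ringCon.mk' x)
  rw [eq_comm, ← sub_eq_zero, ← map_sub, ← map_sub, TwoSidedIdeal.mk'_eq_zero_iff]
  exact sub_avoiding_mem_arrowIdeal x

end BoundQuiverAlgebra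

end

theorem theoremB {k : Type u} [Field k] {V : Type v} [Quiver.{w} V] [Fintype V]
    [∀ a b : V, Finite (a ⟶ b)] (I : TwoSidedIdeal (PathAlgebra k V)) (hI : IsAdmissible I)
    (A : Set (Quiver.Total V)) (hA : IsRemovable I A) :
    (littleFinitisticDim (QuiverAlgebra I) < ⊤ ↔
      littleFinitisticDim (arrowIdeal I A).ringCon.Quotient < ⊤) ∧
    (bigFinitisticDim (QuiverAlgebra I) < ⊤ ↔
      bigFinitisticDim (arrowIdeal I A).ringCon.Quotient < ⊤) ∧
    (globalDim (QuiverAlgebra I) < ⊤ ↔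
      globalDim (arrowIdeal I A).ringCon.Quotient < ⊤) := by
  have hpre : IsPreRemovable I A := hA.elim (fun h => h.1) (fun h => h.1)
  have hright : FiniteRightProjDim I A := hA.elim (fun h => h.2.1) (fun h => h.2.2.1)
  have hK := (projectiveDimension_lt_top_iff _).1 hright
  obtain ⟨i, hpi⟩ := hpre.exists_section
  have hR := hI.isNoetherianRing
  have hp := (arrowIdeal I A).ringCon.mk'_surjective
  have hS := isNoetherianRing_of_surjective _ _ _ hp
  have hj : ∀ r, (arrowIdeal I A).ringCon.mk'.op r = 0 ↔
      r ∈ Set.range (arrowIdeal I A).subtypeMop := by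
    intro r
    constructor
    · intro h
      exact ⟨⟨r.unop, ((arrowIdeal I A).mk'_eq_zero_iff _).1
        (congrArg MulOpposite.unop h)⟩, rfl⟩
    · rintro ⟨x, rfl⟩
      exact MulOpposite.unop_injective (((arrowIdeal I A).mk'_eq_zero_iff _).2 x.2)
  have hquot := hasSyzygyTransfer_projection _ i hpi
    (fun X _ _ => hI.subsingleton_of_span_arrowIdeal_smul_eq_top A X)
    (arrowIdeal I A).subtypeMop (arrowIdeal I A).subtypeMop_injective hj hK
  refine ⟨⟨fun h => ?_, hquot.littleFinitisticDim_lt_top⟩,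
    ⟨fun h => ?_, hquot.bigFinitisticDim_lt_top⟩,
    ⟨globalDim_lt_top_of_section _ i hpi, hquot.globalDim_lt_top⟩⟩
  all_goals
    have hj' : ∀ r, (arrowIdeal I A).ringCon.mk' r = 0 ↔
        r ∈ Set.range (arrowIdeal I A).subtype := fun r => by
      rw [TwoSidedIdeal.mk'_eq_zero_iff]
      exact ⟨fun h => ⟨⟨r, h⟩, rfl⟩, fun ⟨x, hx⟩ => hx ▸ x.2⟩
    have hsec : IsNonRepetitive I A → HasSyzygyTransfer i := fun hsq =>
      hasSyzygyTransfer_section _ i hpi (arrowIdeal I A).subtypeMop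
        (arrowIdeal I A).subtypeMop_injective hj (fun r hr x => by
          obtain ⟨y, rfl⟩ := (hj r).1 hr
          exact Subtype.ext (hsq _ x.2 _ y.2)) hK
  · obtain hA | hA := hA
    · exact littleFinitisticDim_lt_top_of_section _ i hpi (arrowIdeal I A).subtype
        (arrowIdeal I A).subtype_injective hj' ((projectiveDimension_lt_top_iff _).1 hA.2.2) h
    · exact (hsec hA.2.1).littleFinitisticDim_lt_top h
  · obtain hA | hA := hA
    · exact bigFinitisticDim_lt_top_of_section _ i hpi (arrowIdeal I A).subtype
        (arrowIdeal I A).subtype_injective hj' ((projectiveDimension_lt_top_iff _).1 hA.2.2) h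
    · exact (hsec hA.2.1).bigFinitisticDim_lt_top h
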